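/- Let $K$ be an algebraically closed field, let $G$ be a reductive (not necessarily connected) affine algebraic group over $K$, and let $H$ be a finite central subgroup of $G$ whose order is non-zero in $K$ (for instance, $K=\mathbb C$ and $H$ any finite central subgroup). The affine algebraic group $G/H$ has as regular functions the functions whose pullback to $G$ is regular. For a group $\Gamma$ with generators $\gamma_1,\dots,\gamma_N$, regard $\mathrm{Hom}(\Gamma,G)$ as an algebraic subset of $G^N$ via $\rho\mapsto(\rho(\gamma_1),\dots,\rho(\gamma_N))$. Let $X_G(\Gamma)=\mathrm{Hom}(\Gamma,G)/\!/G$ be the categorical quotient by conjugation (the affine variety with coordinate ring $K[\mathrm{Hom}(\Gamma,G)]^G$). Let $\mathrm{Hom}^0(\Gamma,G)$ be the connected component of the trivial representation in $\mathrm{Hom}(\Gamma,G)$ in the Zariski topology, and let $X^0_G(\Gamma)$ be its image in $X_G(\Gamma)$. Use the same notation for $G/H$ in place of $G$. The group $\mathrm{Hom}(\Gamma,H)$ acts on $\mathrm{Hom}(\Gamma,G)$ by $(\sigma\cdot\rho)(\gamma)=\sigma(\gamma)\rho(\gamma)$, and hence on $X_G(\Gamma)$. Let $\mathrm{Hom}'(\Gamma,H)$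 be the subgroup of those $\sigma$ that map $\mathrm{Hom}^0(\Gamma,G)$ to itself; it acts on $\mathrm{Hom}^0(\Gamma,G)$ and on $X^0_G(\Gamma)$. The regular functions on a quotient by one of these finite groups are the invariant regular functions, and an isomorphism is a bijection that, together with its inverse, pulls regular functions back to regular functions. Then: 1. For every finitely generated group $\Gamma$, the projection $G\to G/H$ induces an isomorphism $$\phi:\mathrm{Hom}^0(\Gamma,G)/\mathrm{Hom}'(\Gamma,H)\to \mathrm{Hom}^0(\Gamma,G/H),$$ which sends the class of $\rho$ to the composition of $\rho$ with the projection. 2. Furthermore, $\phi$ descends to an isomorphism $$\psi: X^0_G(\Gamma)/\mathrm{Hom}'(\Gamma,H)\to X^0_{G/H}(\Gamma).$$ 3. For every $N\ge 0$ and the free group $F_N$ of rank $N$, the projection $G\to G/H$ induces an isomorphism $$\psi: X_G(F_N)/H^N\to X_{G/H}(F_N),$$ where $H^N=\mathrm{Hom}(F_N,H)$ acts as above. -/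

import Mathlib

open scoped Pointwise

namespace CharacterVariety

/-! ### Sets with an algebra of regular functions

An affine variety over `K` is handled classically: a set `X` of points together with its algebra
`A : Subalgebra K (X → K)` of regular functions. -/

section Varieties

variable {K : Type*} [Field K] {X Y : Type*}

/-- Pullback of functions along a map, as an algebra homomorphism. -/
def pullback (K : Type*) [Field K] (u : X → Y) : (Y → K) →ₐ[K] (X → K) where
  toFun f := f ∘ u
  map_one' := rfl
  map_mul' _ _ := rfl
  map_zero' := rfl
  map_add' _ _ := rfl
  commutes' _ := rfl

/-- `X` with the algebra `A` of functions is an affine variety (an affine algebraic set): `A` is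
finitely generated and the points of `X` are exactly the `K`-algebra homomorphisms `A → K`. -/
structure IsAffineVariety (A : Subalgebra K (X → K)) : Prop where
  fg : A.FG
  bijective_eval :
    Function.Bijective fun x : X => (Pi.evalAlgHom K (fun _ : X => K) x).comp A.val

/-- The Zariski topology: the sets `{f ≠ 0}`, `f` regular, are the basic open sets. -/
abbrev zariski (A : Subalgebra K (X → K)) : TopologicalSpace X :=
  TopologicalSpace.generateFrom {U | ∃ f ∈ A, U = {x | f x ≠ 0}}

/-- Regular functions on the power `X ^ ι`: generated by the regular functions of the
individual coordinates. -/
def powerRegular (ι : Type*) (A : Subalgebra K (X → K)) : Subalgebra K ((ι → X) → K) :=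
  Algebra.adjoin K {F | ∃ i : ι, ∃ f ∈ A, F = fun x => f (x i)}

/-- Regular functions on a (closed) subset `S`: restrictions of regular functions. -/
def restrictRegular (A : Subalgebra K (X → K)) (S : Set X) : Subalgebra K (S → K) :=
  A.map (pullback K (Subtype.val : S → X))

/-- Regular functions on a quotient `p : X → Y`: the functions on `Y` that are regular on `X`. -/
def quotientRegular (A : Subalgebra K (X → K)) (p : X → Y) : Subalgebra K (Y → K) :=
  A.comap (pullback K p)

/-- `u : X → Y` is an isomorphism: it is bijective, and `u` and its inverse pull regular
functions back to regular functions. -/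
def IsIsomorphism (A : Subalgebra K (X → K)) (B : Subalgebra K (Y → K)) (u : X → Y) : Prop :=
  Function.Bijective u ∧ ∀ f : Y → K, f ∈ B ↔ f ∘ u ∈ A

/-- Regular functions on the orbit space `X / M` : the regular functions on `X` that are constant
on the orbits. -/
def orbitRegular (M : Type*) [Group M] [MulAction M X] (A : Subalgebra K (X → K)) :
    Subalgebra K (MulAction.orbitRel.Quotient M X → K) :=
  quotientRegular A (fun x => (Quotient.mk _ x : MulAction.orbitRel.Quotient M X))

end Varieties

/-! ### Affine algebraic groups -/

section Groups

variable {K : Type*} [Field K] {G : Type*} [Group G]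

/-- `G` with the algebra `A` of regular functions is an affine algebraic group: an affine variety
whose multiplication and inversion are morphisms. -/
class IsAffineAlgebraicGroup (A : Subalgebra K (G → K)) : Prop where
  affine : IsAffineVariety A
  mul_regular : ∀ f ∈ A, (fun x : Fin 2 → G => f (x 0 * x 1)) ∈ powerRegular (Fin 2) A
  inv_regular : ∀ f ∈ A, (fun x : G => f x⁻¹) ∈ A

/-- `g` is unipotent: right translation by `g` is a locally unipotent operator on the regular
functions. -/
def IsUnipotent (A : Subalgebra K (G → K)) (g : G) : Prop :=
  ∀ f ∈ A, ∃ n : ℕ, ((LinearMap.funLeft K K (fun x : G => x * g) - 1) ^ n) f = 0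

/-- `G` is reductive: the only Zariski closed connected normal subgroup that consists of
unipotent elements is the trivial one. `G` need not be connected. -/
def IsReductive (A : Subalgebra K (G → K)) : Prop :=
  ∀ U : Subgroup G, U.Normal → @IsClosed G (zariski A) (U : Set G) →
    @IsConnected G (zariski A) (U : Set G) → (∀ u ∈ U, IsUnipotent A u) → U = ⊥

/-- `H` is a central subgroup. -/
class IsCentralSubgroup (H : Subgroup G) : Prop where
  le_center : H ≤ Subgroup.center G

theorem IsCentralSubgroup.comm (H : Subgroup G) [IsCentralSubgroup H] (h : H) (g : G) :
    g * (h : G) = (h : G) * g :=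
  Subgroup.mem_center_iff.1 (IsCentralSubgroup.le_center h.2) g

instance (H : Subgroup G) [IsCentralSubgroup H] : H.Normal where
  conj_mem h hh g := by
    rw [IsCentralSubgroup.comm H ⟨h, hh⟩ g, mul_inv_cancel_right]
    exact hh

instance (priority := 50) centralCommGroup (H : Subgroup G) [IsCentralSubgroup H] :
    CommGroup H :=
  { (inferInstance : Group H) with
    mul_comm := fun a b => Subtype.ext (IsCentralSubgroup.comm H b (a : G)) }

/-- Regular functions on `G / H`. -/
abbrev quotientGroupRegular (A : Subalgebra K (G → K)) (H : Subgroup G) :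
    Subalgebra K (G ⧸ H → K) :=
  quotientRegular A (fun g : G => (g : G ⧸ H))

theorem mul_left_regular (A : Subalgebra K (G → K)) [IsAffineAlgebraicGroup A] (g : G)
    {f : G → K} (hf : f ∈ A) : (fun x => f (g * x)) ∈ A := by
  have key : powerRegular (Fin 2) A ≤ A.comap (pullback K (fun x : G => ![g, x])) := by
    refine Algebra.adjoin_le ?_
    rintro F ⟨i, f, hf, rfl⟩
    fin_cases i
    · exact A.algebraMap_mem (f g)
    · exact hf
  exact key (IsAffineAlgebraicGroup.mul_regular f hf)

end Groups

/-! ### Representation varieties -/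

section Representations

variable {K : Type*} [Field K] {G : Type*} [Group G] {Γ : Type*} [Group Γ] {N : ℕ}

/-- Regular functions on `Hom(Γ, G)`, seen as a subset of `G ^ N` through `ρ ↦ (ρ (s i))_i`, where
`s` lists generators of `Γ`. -/
def homRegular (s : Fin N → Γ) (A : Subalgebra K (G → K)) : Subalgebra K ((Γ →* G) → K) :=
  (powerRegular (Fin N) A).map (pullback K (fun (ρ : Γ →* G) (i : Fin N) => ρ (s i)))

/-- `Hom⁰(Γ, G)`: the connected component of the trivial representation in `Hom(Γ, G)`. -/
def hom0 (s : Fin N → Γ) (A : Subalgebra K (G → K)) : Set (Γ →* G) :=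
  @connectedComponent (Γ →* G) (zariski (homRegular s A)) 1

/-- Regular functions on `Hom⁰(Γ, G)`. -/
abbrev hom0Regular (s : Fin N → Γ) (A : Subalgebra K (G → K)) :
    Subalgebra K (hom0 s A → K) :=
  restrictRegular (homRegular s A) (hom0 s A)

/-- The representation conjugate to `ρ` by `g`. -/
def conj (g : G) (ρ : Γ →* G) : Γ →* G := (MulAut.conj g).toMonoidHom.comp ρ

/-- The algebra `K[Hom(Γ, G)]^G` of conjugation invariant regular functions. -/
def invariants (s : Fin N → Γ) (A : Subalgebra K (G → K)) : Subalgebra K ((Γ →* G) → K) where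
  carrier := {f | f ∈ homRegular s A ∧ ∀ (g : G) (ρ : Γ →* G), f (conj g ρ) = f ρ}
  mul_mem' := fun ha hb =>
    ⟨mul_mem ha.1 hb.1, fun g ρ => by simp only [Pi.mul_apply, ha.2 g ρ, hb.2 g ρ]⟩
  add_mem' := fun ha hb =>
    ⟨add_mem ha.1 hb.1, fun g ρ => by simp only [Pi.add_apply, ha.2 g ρ, hb.2 g ρ]⟩
  algebraMap_mem' := fun r => ⟨(homRegular s A).algebraMap_mem r, fun _ _ => rfl⟩

/-- The `G`-character variety `X_G(Γ) = Hom(Γ, G) // G`: the points of the categorical quotient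
are the `K`-algebra homomorphisms `K[Hom(Γ, G)]^G → K`. -/
def CharVar (s : Fin N → Γ) (A : Subalgebra K (G → K)) : Type _ := invariants s A →ₐ[K] K

/-- Regular functions on `X_G(Γ)`: the elements of `K[Hom(Γ, G)]^G`, evaluated at points. -/
def charRegular (s : Fin N → Γ) (A : Subalgebra K (G → K)) :
    Subalgebra K (CharVar s A → K) :=
  (AlgHom.pi (fun x : CharVar s A => (x : invariants s A →ₐ[K] K))).range

/-- The quotient map `Hom(Γ, G) → X_G(Γ)`. -/
def toChar (s : Fin N → Γ) (A : Subalgebra K (G → K)) (ρ : Γ →* G) : CharVar s A :=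
  (Pi.evalAlgHom K (fun _ : Γ →* G => K) ρ).comp (invariants s A).val

/-- `X⁰_G(Γ)`: the image of `Hom⁰(Γ, G)` in `X_G(Γ)`. -/
def char0 (s : Fin N → Γ) (A : Subalgebra K (G → K)) : Set (CharVar s A) :=
  toChar s A '' hom0 s A

/-- Regular functions on `X⁰_G(Γ)`. -/
abbrev char0Regular (s : Fin N → Γ) (A : Subalgebra K (G → K)) :
    Subalgebra K (char0 s A → K) :=
  restrictRegular (charRegular s A) (char0 s A)

/-- The class in `X⁰_G(Γ)` of a representation in `Hom⁰(Γ, G)`. -/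
def toChar0 (s : Fin N → Γ) (A : Subalgebra K (G → K)) (ρ : hom0 s A) : char0 s A :=
  ⟨toChar s A ρ, Set.mem_image_of_mem _ ρ.2⟩

/-! ### The action of `Hom(Γ, H)` -/

variable (H : Subgroup G) [IsCentralSubgroup H]

/-- `Hom(Γ, H)` acts on `Hom(Γ, G)` by `(σ • ρ) γ = σ γ * ρ γ`. -/
instance homAction : MulAction (Γ →* H) (Γ →* G) where
  smul σ ρ :=
    { toFun := fun γ => (σ γ : G) * ρ γ
      map_one' := by simp
      map_mul' := fun a b => by
        simp only [map_mul, Subgroup.coe_mul, mul_assoc]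
        rw [← mul_assoc (ρ a), IsCentralSubgroup.comm H (σ b) (ρ a), mul_assoc] }
  one_smul ρ := by ext γ; exact one_mul (ρ γ)
  mul_smul σ τ ρ := by ext γ; exact mul_assoc (σ γ : G) (τ γ : G) (ρ γ)

theorem smul_apply (σ : Γ →* H) (ρ : Γ →* G) (γ : Γ) : (σ • ρ) γ = (σ γ : G) * ρ γ := rfl

theorem smul_conj (σ : Γ →* H) (g : G) (ρ : Γ →* G) : σ • conj g ρ = conj g (σ • ρ) := by
  ext γ
  simp only [smul_apply, conj, MonoidHom.comp_apply, MulEquiv.coe_toMonoidHom,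
    MulAut.conj_apply, ← mul_assoc]
  rw [IsCentralSubgroup.comm H (σ γ) g]

variable {H}

theorem homRegular_smul (s : Fin N → Γ) (A : Subalgebra K (G → K)) [IsAffineAlgebraicGroup A]
    (σ : Γ →* H) {f : (Γ →* G) → K} (hf : f ∈ homRegular s A) :
    (fun ρ => f (σ • ρ)) ∈ homRegular s A := by
  obtain ⟨F, hF, rfl⟩ := hf
  have key : powerRegular (Fin N) A ≤ (powerRegular (Fin N) A).comap
      (pullback K (fun (x : Fin N → G) (i : Fin N) => (σ (s i) : G) * x i)) := by
    refine Algebra.adjoin_le ?_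
    rintro F ⟨i, f, hf, rfl⟩
    exact Algebra.subset_adjoin ⟨i, _, mul_left_regular A (σ (s i) : G) hf, rfl⟩
  exact ⟨_, key hF, rfl⟩

/-- The action of `σ` on invariant functions, `f ↦ f (σ • ·)`. -/
def invariantsSMul (s : Fin N → Γ) (A : Subalgebra K (G → K)) [IsAffineAlgebraicGroup A]
    (σ : Γ →* H) : invariants s A →ₐ[K] invariants s A where
  toFun f := ⟨fun ρ => (f : (Γ →* G) → K) (σ • ρ), homRegular_smul s A σ f.2.1, fun g ρ => by
    simp only [smul_conj, f.2.2]⟩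
  map_one' := rfl
  map_mul' _ _ := rfl
  map_zero' := rfl
  map_add' _ _ := rfl
  commutes' _ := rfl

/-- The induced action of `Hom(Γ, H)` on `X_G(Γ)`; `σ` sends the class of `ρ` to that of
`σ • ρ`. -/
instance charAction (s : Fin N → Γ) (A : Subalgebra K (G → K)) [IsAffineAlgebraicGroup A] :
    MulAction (Γ →* H) (CharVar s A) where
  smul σ x := AlgHom.comp x (invariantsSMul s A σ)
  one_smul x := by
    have h (f : invariants s A) : invariantsSMul s A (1 : Γ →* H) f = f :=
      Subtype.ext <| funext fun ρ => congrArg (f : (Γ →* G) → K) (one_smul (Γ →* H) ρ)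
    exact AlgHom.ext fun f => congrArg (DFunLike.coe (F := invariants s A →ₐ[K] K) x) (h f)
  mul_smul σ τ x := by
    have h (f : invariants s A) :
        invariantsSMul s A (σ * τ) f = invariantsSMul s A τ (invariantsSMul s A σ f) :=
      Subtype.ext <| funext fun ρ => congrArg (f : (Γ →* G) → K) (mul_smul σ τ ρ)
    exact AlgHom.ext fun f => congrArg (DFunLike.coe (F := invariants s A →ₐ[K] K) x) (h f)

theorem smul_toChar (s : Fin N → Γ) (A : Subalgebra K (G → K)) [IsAffineAlgebraicGroup A]
    (σ : Γ →* H) (ρ : Γ →* G) : σ • toChar s A ρ = toChar s A (σ • ρ) := rfl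

variable (H) in
/-- `Hom'(Γ, H)`: the elements of `Hom(Γ, H)` that map `Hom⁰(Γ, G)` to itself. As a stabilizer it
acts on the set `Hom⁰(Γ, G)`. -/
abbrev hom' (s : Fin N → Γ) (A : Subalgebra K (G → K)) : Subgroup (Γ →* H) :=
  MulAction.stabilizer (Γ →* H) (hom0 s A)

/-- The induced action of `Hom'(Γ, H)` on `X⁰_G(Γ)`. -/
instance char0Action (s : Fin N → Γ) (A : Subalgebra K (G → K)) [IsAffineAlgebraicGroup A] :
    MulAction (hom' H s A) (char0 s A) where
  smul σ x := ⟨(σ : Γ →* H) • (x : CharVar s A), by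
    obtain ⟨_, ρ, hρ, rfl⟩ := x
    exact ⟨(σ • (⟨ρ, hρ⟩ : hom0 s A) : hom0 s A), (σ • (⟨ρ, hρ⟩ : hom0 s A)).2, rfl⟩⟩
  one_smul x := Subtype.ext (one_smul (Γ →* H) (x : CharVar s A))
  mul_smul σ τ x := Subtype.ext (mul_smul (σ : Γ →* H) (τ : Γ →* H) (x : CharVar s A))

/-- The identification of `H ^ N` with `Hom(F_N, H)`, a tuple being sent to the homomorphism with
these values on the free generators. -/
def tupleToHom (N : ℕ) (H : Subgroup G) [IsCentralSubgroup H] :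
    (Fin N → H) →* (FreeGroup (Fin N) →* H) where
  toFun h := FreeGroup.lift h
  map_one' := by ext i; simp
  map_mul' h k := by ext i; simp

/-- The action of `H ^ N` on `X_G(F_N)`. -/
instance freeCharAction (A : Subalgebra K (G → K)) [IsAffineAlgebraicGroup A] :
    MulAction (Fin N → H) (CharVar (FreeGroup.of : Fin N → FreeGroup (Fin N)) A) :=
  MulAction.compHom _ (tupleToHom N H)

end Representations

/-- The map `Hom(Γ, G) → Hom(Γ, G / H)` induced by the projection `G → G / H`. -/
def project {G Γ : Type*} [Group G] [Group Γ] (H : Subgroup G) [H.Normal] (ρ : Γ →* G) :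
    Γ →* G ⧸ H :=
  (QuotientGroup.mk' H).comp ρ

end CharacterVariety

/-! A tuple in $G^N$ is called liftable if its image in $(G/H)^N$ defines a representation of
$\Gamma$. The liftable tuples form a closed $H^N$-stable subset $L$ of $G^N$, with orbit set
$\mathrm{Hom}(\Gamma,G/H)$. Since $|H|$ is invertible, averaging over $H^N$ identifies the regular
functions on $\mathrm{Hom}(\Gamma,G/H)$ with the $H^N$-invariant ones on $L$
(`mem_homRegular_quotientGroupRegular_iff`).

On $L$ every relator of $\Gamma$ is a morphism to the finite group $H$, hence locally constant. So
the component $C$ of the trivial tuple consists of representations into $G$, and it is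
$\mathrm{Hom}^0(\Gamma,G)$ (`image_tupleOfHom_hom0`). A quotient by a finite group maps components
onto components, whence $\mathrm{Hom}^0(\Gamma,G)\to\mathrm{Hom}^0(\Gamma,G/H)$ is onto
(`project_image_hom0`). Two points in a fibre differ by some $\sigma\in\mathrm{Hom}(\Gamma,H)$; as
$\sigma$ moves one point of $\mathrm{Hom}^0$ into $\mathrm{Hom}^0$, it lies in $\mathrm{Hom}'$.

For regular functions, a $\mathrm{Hom}'$-invariant function on $\mathrm{Hom}^0(\Gamma,G)$ spreads
over the $H^N$-orbit of the clopen set $C$ and extends by zero to $L$; the result is regular and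
descends (`exists_homRegular_descent`). The construction respects conjugation
(`exists_invariants_descent`), which gives the functions in the second claim; injectivity there
holds because invariants of a finite group separate its orbits (`exists_smul_of_invariants_eq`).

For a free group every tuple is a representation, so $K[X_{G/H}]=K[X_G]^{H^N}$. This extension is
integral, so points lift, and orbits are again separated by invariants. -/

namespace CharacterVariety

open scoped Topology

/-! ### The Zariski topology of an algebra of functions; components and their indicators. -/

section Zariski

variable {K : Type*} [Field K] {X Y : Type*}

theorem isOpen_zariski_iff {A : Subalgebra K (X → K)} {U : Set X} :
    IsOpen[zariski A] U ↔ ∀ x ∈ U, ∃ f ∈ A, f x ≠ 0 ∧ ∀ y, f y ≠ 0 → y ∈ U := by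
  constructor
  · intro h
    induction h with
    | basic s hs =>
      obtain ⟨f, hf, rfl⟩ := hs
      exact fun x hx => ⟨f, hf, hx, fun _ h => h⟩
    | univ => exact fun x _ => ⟨1, one_mem A, one_ne_zero, fun _ _ => trivial⟩
    | inter s t _ _ hs ht =>
      rintro x ⟨h1, h2⟩
      obtain ⟨f, hf, hfx, hf'⟩ := hs x h1
      obtain ⟨g, hg, hgx, hg'⟩ := ht x h2
      exact ⟨f * g, mul_mem hf hg, mul_ne_zero hfx hgx, fun y hy =>
        ⟨hf' y (left_ne_zero_of_mul hy), hg' y (right_ne_zero_of_mul hy)⟩⟩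
    | sUnion S _ ih =>
      rintro x ⟨s, hs, hx⟩
      obtain ⟨f, hf, hfx, hf'⟩ := ih s hs x hx
      exact ⟨f, hf, hfx, fun y hy => ⟨s, hs, hf' y hy⟩⟩
  · intro h
    have : U = ⋃₀ {V | ∃ f ∈ A, V = {x | f x ≠ 0} ∧ V ⊆ U} := by
      ext x
      constructor
      · intro hx
        obtain ⟨f, hf, hfx, hf'⟩ := h x hx
        exact ⟨{x | f x ≠ 0}, ⟨f, hf, rfl, hf'⟩, hfx⟩
      · rintro ⟨V, ⟨f, hf, rfl, hV⟩, hx⟩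
        exact hV hx
    rw [this]
    refine @isOpen_sUnion X (zariski A) _ ?_
    rintro V ⟨f, hf, rfl, -⟩
    exact TopologicalSpace.isOpen_generateFrom_of_mem ⟨f, hf, rfl⟩

theorem isClosed_zariski_iff {A : Subalgebra K (X → K)} {Z : Set X} :
    IsClosed[zariski A] Z ↔ ∀ x ∉ Z, ∃ f ∈ A, f x ≠ 0 ∧ ∀ y ∈ Z, f y = 0 := by
  rw [← @isOpen_compl_iff X Z (zariski A), isOpen_zariski_iff]
  refine forall₂_congr fun x _ => exists_congr fun f => and_congr_right fun _ =>
    and_congr_right fun _ => forall_congr' fun y => ?_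
  rw [Set.mem_compl_iff, ← not_imp_not, not_not, not_not]

theorem continuous_zariski {A : Subalgebra K (X → K)} {B : Subalgebra K (Y → K)} {u : X → Y}
    (h : ∀ f ∈ B, f ∘ u ∈ A) : @Continuous X Y (zariski A) (zariski B) u := by
  refine continuous_generateFrom_iff.2 ?_
  rintro _ ⟨f, hf, rfl⟩
  exact TopologicalSpace.isOpen_generateFrom_of_mem ⟨f ∘ u, h f hf, rfl⟩

theorem zariski_map_pullback (B : Subalgebra K (Y → K)) (u : X → Y) :
    zariski (B.map (pullback K u)) = (zariski B).induced u := by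
  rw [zariski, zariski, induced_generateFrom_eq]
  congr 1
  ext U
  constructor
  · rintro ⟨_, ⟨f, hf, rfl⟩, rfl⟩
    exact ⟨_, ⟨f, hf, rfl⟩, rfl⟩
  · rintro ⟨_, ⟨f, hf, rfl⟩, rfl⟩
    exact ⟨_, ⟨f, hf, rfl⟩, rfl⟩

/-- The prime ideal of the regular functions vanishing at a point. -/
def pointToPrime (A : Subalgebra K (X → K)) (x : X) : PrimeSpectrum A :=
  ⟨RingHom.ker ((Pi.evalAlgHom K (fun _ : X => K) x).comp A.val), RingHom.ker_isPrime _⟩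

theorem zariski_eq_induced (A : Subalgebra K (X → K)) :
    zariski A = TopologicalSpace.induced (pointToPrime A) inferInstance := by
  rw [PrimeSpectrum.isTopologicalBasis_basic_opens.eq_generateFrom, induced_generateFrom_eq]
  refine congrArg _ (Set.ext fun U => ⟨?_, ?_⟩)
  · rintro ⟨f, hf, rfl⟩
    exact ⟨_, ⟨⟨f, hf⟩, rfl⟩, rfl⟩
  · rintro ⟨_, ⟨f, rfl⟩, rfl⟩
    exact ⟨f, f.2, rfl⟩

/-- The topology is induced from the spectrum of a finitely generated algebra, and that spectrum is
Noetherian. -/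
theorem noetherianSpace_zariski {A : Subalgebra K (X → K)} (hA : A.FG) :
    @TopologicalSpace.NoetherianSpace X (zariski A) := by
  have : Algebra.FiniteType K A := A.fg_iff_finiteType.1 hA
  have : IsNoetherianRing A := Algebra.FiniteType.isNoetherianRing K A
  let _ := zariski A
  exact Topology.IsInducing.noetherianSpace (i := pointToPrime A) ⟨zariski_eq_induced A⟩

/-- The complement is the union of the irreducible components that miss the connected component, and
there are only finitely many of them. -/
theorem isClopen_connectedComponent_of_noetherianSpace [TopologicalSpace X]
    [TopologicalSpace.NoetherianSpace X] (x : X) : IsClopen (connectedComponent x) := by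
  refine ⟨isClosed_connectedComponent, isClosed_compl_iff.1 ?_⟩
  have : (connectedComponent x)ᶜ =
      ⋃ Z ∈ {Z ∈ irreducibleComponents X | Disjoint Z (connectedComponent x)}, Z := by
    ext y
    simp only [Set.mem_iUnion, Set.mem_compl_iff, Set.mem_ofPred_eq, exists_prop]
    constructor
    · intro hy
      refine ⟨irreducibleComponent y, ⟨irreducibleComponent_mem_irreducibleComponents y, ?_⟩,
        mem_irreducibleComponent⟩
      rw [Set.disjoint_left]
      intro z hz hzx
      apply hy
      rw [connectedComponent_eq hzx]
      exact isIrreducible_irreducibleComponent.isConnected.isPreconnected.subset_connectedComponent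
        hz mem_irreducibleComponent
    · rintro ⟨Z, ⟨-, hZ⟩, hy⟩ hyx
      exact Set.disjoint_left.1 hZ hy hyx
  rw [this]
  exact (TopologicalSpace.NoetherianSpace.finite_irreducibleComponents.subset
    (Set.sep_subset _ _)).isClosed_biUnion
      fun Z hZ => isClosed_of_mem_irreducibleComponents Z hZ.1

/-- Every `K`-algebra homomorphism on the regular functions is evaluation at a point. -/
def HasPoints (A : Subalgebra K (X → K)) : Prop :=
  ∀ χ : A →ₐ[K] K, ∃ x : X, ∀ f : A, χ f = (f : X → K) x

theorem exists_algHom_of_isMaximal [IsAlgClosed K] {R : Type*} [CommRing R] [Algebra K R]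
    [Algebra.FiniteType K R] (P : Ideal R) [P.IsMaximal] :
    ∃ χ : R →ₐ[K] K, ∀ r ∈ P, χ r = 0 := by
  let _ := Ideal.Quotient.field P
  have : Module.Finite K (R ⧸ P) := finite_of_finite_type_of_isJacobsonRing K (R ⧸ P)
  let e := AlgEquiv.ofBijective (Algebra.ofId K (R ⧸ P))
    (IsAlgClosed.algebraMap_bijective_of_isIntegral (k := K) (K := R ⧸ P))
  refine ⟨(e.symm : (R ⧸ P) →ₐ[K] K).comp (Ideal.Quotient.mkₐ K P), fun r hr => ?_⟩
  simp [Ideal.Quotient.eq_zero_iff_mem.2 hr]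

/-- By the Nullstellensatz, a maximal ideal containing the ideals of both $C$ and its complement
would give a point in both closed sets. So the two ideals are comaximal, and in $1=a+b$ the summand
$b$ is the indicator. -/
theorem indicator_mem_of_isClopen [IsAlgClosed K] {A : Subalgebra K (X → K)} (hfg : A.FG)
    (hA : HasPoints A) {C : Set X} (hC : @IsClopen X (zariski A) C) :
    C.indicator (1 : X → K) ∈ A := by
  have : Algebra.FiniteType K A := A.fg_iff_finiteType.1 hfg
  let I (S : Set X) : Ideal A :=
    { carrier := {f | ∀ x ∈ S, (f : X → K) x = 0}
      add_mem' := fun ha hb x hx => by simp [ha x hx, hb x hx]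
      zero_mem' := fun _ _ => rfl
      smul_mem' := fun c f hf x hx => by simp [hf x hx] }
  have htop : I C ⊔ I Cᶜ = ⊤ := by
    by_contra hne
    obtain ⟨P, hP, hle⟩ := Ideal.exists_le_maximal _ hne
    obtain ⟨χ, hχ⟩ := exists_algHom_of_isMaximal (K := K) P
    obtain ⟨x, hx⟩ := hA χ
    have key (S : Set X) (hS : IsClosed[zariski A] S) (hSP : I S ≤ P) : x ∈ S := by
      by_contra hxS
      obtain ⟨f, hf, hfx, hf0⟩ := isClosed_zariski_iff.1 hS x hxS
      exact hfx ((hx ⟨f, hf⟩).symm.trans (hχ _ (hSP fun y hy => hf0 y hy)))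
    exact key Cᶜ (@isClosed_compl_iff X (zariski A) C |>.2 hC.2) (le_sup_right.trans hle)
      (key C hC.1 (le_sup_left.trans hle))
  obtain ⟨a, ha, b, hb, hab⟩ := Submodule.mem_sup.1 ((Ideal.eq_top_iff_one _).1 htop)
  convert b.2
  ext x
  have h1 : (a : X → K) x + (b : X → K) x = 1 := congrArg (fun f : A => (f : X → K) x) hab
  by_cases hx : x ∈ C
  · rw [Set.indicator_of_mem hx, Pi.one_apply, ← h1, ha x hx, zero_add]
  · rw [Set.indicator_of_notMem hx, hb x hx]

end Zariski

/-! ### Finite groups acting on a variety -/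

section FiniteGroup

variable {K : Type*} [Field K] {X Z M : Type*} [Group M] [Finite M] [MulAction M X]
  {A : Subalgebra K (X → K)}

/-- The witness is $\prod_m (F(y)-F(mx)) - F(y)^{|M|}$, a norm rather than an average, so $|M|$ need
not be invertible in $K$. At $x=y$ the factor for $m=1$ vanishes, leaving $-F(y)^{|M|}$. -/
theorem exists_invariant_mem (hM : ∀ (m : M), ∀ f ∈ A, (fun x => f (m • x)) ∈ A)
    {F : X → K} (hF : F ∈ A) {y : X} (hy : F y ≠ 0) :
    ∃ g ∈ A, (∀ (m : M) x, g (m • x) = g x) ∧ g y ≠ 0 ∧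
      ∀ x, (∀ m : M, F (m • x) = 0) → g x = 0 := by
  have := Fintype.ofFinite M
  refine ⟨fun x => ∏ m : M, (F y - F (m • x)) - ∏ _m : M, F y, ?_, fun m x => ?_, ?_, ?_⟩
  · have h : (∏ m : M, (algebraMap K (X → K) (F y) - fun x => F (m • x)) -
        ∏ _m : M, algebraMap K (X → K) (F y)) ∈ A :=
      sub_mem (prod_mem fun m _ => sub_mem (A.algebraMap_mem _) (hM m F hF))
        (prod_mem fun m _ => A.algebraMap_mem _)
    convert h using 1
    ext x
    simp
  · simp only [← mul_smul]
    rw [Fintype.prod_equiv (Equiv.mulRight m) (fun k => F y - F ((k * m) • x))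
      (fun k => F y - F (k • x)) fun k => rfl]
  · beta_reduce
    rw [Finset.prod_eq_zero (Finset.mem_univ (1 : M)) (by simp), zero_sub, neg_ne_zero]
    exact Finset.prod_ne_zero_iff.2 fun _ _ => hy
  · intro x hx
    simp [hx]

/-- The conclusion is agreement of all functions in `A`, not equality of points. So `A` may fail to
separate points, as the conjugation invariants do on a space of representations. -/
theorem exists_smul_of_invariants_eq (hM : ∀ (m : M), ∀ f ∈ A, (fun x => f (m • x)) ∈ A)
    {x y : X} (h : ∀ g ∈ A, (∀ (m : M) z, g (m • z) = g z) → g x = g y) :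
    ∃ m : M, ∀ f ∈ A, f (m • x) = f y := by
  have := Fintype.ofFinite M
  by_contra! hne
  choose f hf hfne using hne
  -- Each `f m` distinguishes `m • x` from `y`; the product vanishes on the whole orbit of `x` but
  -- not at `y`.
  let F : X → K := ∏ m : M, (f m - algebraMap K (X → K) (f m (m • x)))
  have hF : F ∈ A := prod_mem fun m _ => sub_mem (hf m) (A.algebraMap_mem _)
  have hFy : F y ≠ 0 := by
    simp only [F, Finset.prod_apply, Pi.sub_apply, Finset.prod_ne_zero_iff]
    exact fun m _ => sub_ne_zero.2 (hfne m).symm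
  have hFx (m : M) : F (m • x) = 0 := by
    simp only [F, Finset.prod_apply, Pi.sub_apply]
    exact Finset.prod_eq_zero (Finset.mem_univ m) (by simp)
  obtain ⟨g, hg, hinv, hgy, hg0⟩ := exists_invariant_mem hM hF hFy
  exact hgy ((h g hg hinv).symm.trans (hg0 x hFx))

variable {q : X → Z}

theorem isOpen_image_quotient (hM : ∀ (m : M), ∀ f ∈ A, (fun x => f (m • x)) ∈ A)
    (hq : ∀ x y, q x = q y ↔ ∃ m : M, m • x = y) (hsurj : Function.Surjective q)
    {U : Set X} (hU : IsOpen[zariski A] U) :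
    IsOpen[zariski (quotientRegular A q)] (q '' U) := by
  rw [isOpen_zariski_iff]
  rintro _ ⟨y, hy, rfl⟩
  obtain ⟨F, hF, hFy, hFU⟩ := isOpen_zariski_iff.1 hU y hy
  obtain ⟨g, hg, hinv, hgy, hg0⟩ := exists_invariant_mem hM hF hFy
  have hfac : (fun z => g (Function.surjInv hsurj z)) ∘ q = g := by
    ext x
    obtain ⟨m, hm⟩ := (hq _ _).1 (Function.surjInv_eq hsurj (q x)).symm
    exact (congrArg g hm).symm.trans (hinv m x)
  refine ⟨fun z => g (Function.surjInv hsurj z), ?_, ?_, fun z hz => ?_⟩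
  · change (fun z => g (Function.surjInv hsurj z)) ∘ q ∈ A
    rwa [hfac]
  · exact fun h => hgy ((congrFun hfac y).symm.trans h)
  · by_contra hzU
    refine hz (hg0 _ fun m => ?_)
    by_contra hne
    refine hzU ⟨_, hFU _ hne, ?_⟩
    exact ((hq _ _).2 ⟨m, rfl⟩).symm.trans (Function.surjInv_eq hsurj z)

/-- The image of the component is connected, so it suffices that it is clopen. It is open because
the quotient map is open. -/
theorem image_connectedComponent_quotient (hfg : A.FG)
    (hM : ∀ (m : M), ∀ f ∈ A, (fun x => f (m • x)) ∈ A)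
    (hq : ∀ x y, q x = q y ↔ ∃ m : M, m • x = y) (hsurj : Function.Surjective q) (x : X) :
    q '' @connectedComponent X (zariski A) x =
      @connectedComponent Z (zariski (quotientRegular A q)) (q x) := by
  let _ := zariski A
  let _ := zariski (quotientRegular A q)
  have := noetherianSpace_zariski hfg
  have hcont : Continuous q := continuous_zariski fun f hf => hf
  have hopen {U : Set X} (hU : IsOpen U) : IsOpen (q '' U) :=
    isOpen_image_quotient hM hq hsurj hU
  have hC := isClopen_connectedComponent_of_noetherianSpace x
  refine subset_antisymm ?_ (IsClopen.connectedComponent_subset ⟨?_, hopen hC.2⟩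
    ⟨x, mem_connectedComponent, rfl⟩)
  · exact (isPreconnected_connectedComponent.image q hcont.continuousOn).subset_connectedComponent
      ⟨x, mem_connectedComponent, rfl⟩
  · have hsmul (m : M) : Continuous fun y : X => m • y := continuous_zariski (hM m)
    have hS : IsClosed (⋃ m : M, (fun y => m • y) ⁻¹' connectedComponent x) :=
      isClosed_iUnion_of_finite fun m => hC.1.preimage (hsmul m)
    -- Closedness: the saturation is a finite union of preimages under translations, hence closed,
    -- and the image of its complement is open.
    have : q '' connectedComponent x =
        (q '' (⋃ m : M, (fun y => m • y) ⁻¹' connectedComponent x)ᶜ)ᶜ := by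
      ext z
      obtain ⟨y, rfl⟩ := hsurj z
      simp only [Set.mem_image, Set.mem_compl_iff, Set.mem_iUnion, Set.mem_preimage, not_exists,
        not_and]
      constructor
      · rintro ⟨w, hw, hwy⟩ v hv hvy
        obtain ⟨m, rfl⟩ := (hq v w).1 (hvy.trans hwy.symm)
        exact hv m hw
      · intro h
        by_contra! hne
        exact h y (fun m hm => hne _ hm ((hq _ _).2 ⟨m, rfl⟩).symm) rfl
    rw [this]
    exact (hopen hS.isOpen_compl).isClosed_compl

/-- An invariant function that is regular on a clopen set and vanishes off its orbit is
regular. -/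
theorem mem_of_regular_on_isClopen (hM : ∀ (m : M), ∀ f ∈ A, (fun x => f (m • x)) ∈ A)
    {C : Set X} (hC : C.indicator (1 : X → K) ∈ A) {g F : X → K} (hF : F ∈ A)
    (hinv : ∀ (m : M) x, g (m • x) = g x) (hg : ∀ x ∈ C, g x = F x)
    (h0 : ∀ x, (∀ m : M, m • x ∉ C) → g x = 0) : g ∈ A := by
  have := Fintype.ofFinite M
  let e (m : M) : X → K := fun x => C.indicator 1 (m • x)
  have he (m : M) : e m ∈ A := hM m _ hC
  have hge (m : M) : g * e m ∈ A := by
    convert hM m _ (mul_mem hF hC) using 1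
    ext x
    by_cases hx : m • x ∈ C
    · simp [e, hx, ← hg _ hx, hinv]
    · simp [e, hx]
  -- The factors `1 - e m` cut out the complement of the orbit of `C`, where `g` vanishes. Peeling
  -- them off one at a time leaves terms containing some `g * e m`, which are regular.
  have key (S : Finset M) : g - g * ∏ m ∈ S, (1 - e m) ∈ A := by
    classical
    induction S using Finset.induction_on with
    | empty => simp
    | insert m S hm ih =>
      rw [Finset.prod_insert hm]
      have : g - g * ((1 - e m) * ∏ k ∈ S, (1 - e k)) =
          (g - g * ∏ k ∈ S, (1 - e k)) + (g * e m) * ∏ k ∈ S, (1 - e k) := by ring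
      rw [this]
      exact add_mem ih (mul_mem (hge m) (prod_mem fun k _ => sub_mem (one_mem A) (he k)))
  have hzero : g * ∏ m : M, (1 - e m) = 0 := by
    ext x
    by_cases hx : ∀ m : M, m • x ∉ C
    · simp [h0 x hx]
    · push Not at hx
      obtain ⟨m, hm⟩ := hx
      have : ∏ k : M, (1 - e k x) = 0 :=
        Finset.prod_eq_zero (Finset.mem_univ m) (by simp [e, hm])
      simp [Finset.prod_apply, this]
  simpa [hzero] using key Finset.univ

end FiniteGroup

/-! ### Powers and subvarieties -/

section Powers

variable {K : Type*} [Field K] {X Y ι : Type*}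

theorem comp_mem_of_mem_powerRegular {A : Subalgebra K (Y → K)} {R : Subalgebra K (X → K)}
    {F : (ι → Y) → K} (hF : F ∈ powerRegular ι A) {u : X → ι → Y}
    (hu : ∀ i, ∀ f ∈ A, (fun x => f (u x i)) ∈ R) : (fun x => F (u x)) ∈ R := by
  have : powerRegular ι A ≤ R.comap (pullback K u) := by
    refine Algebra.adjoin_le ?_
    rintro _ ⟨i, f, hf, rfl⟩
    exact hu i f hf
  exact this hF

theorem coordinate_mem_powerRegular {A : Subalgebra K (Y → K)} (i : ι) {f : Y → K} (hf : f ∈ A) :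
    (fun x : ι → Y => f (x i)) ∈ powerRegular ι A :=
  Algebra.subset_adjoin ⟨i, f, hf, rfl⟩

theorem powerRegular_fg [Finite ι] {A : Subalgebra K (Y → K)} (hA : A.FG) :
    (powerRegular ι A).FG := by
  obtain ⟨t, ht, rfl⟩ := Subalgebra.fg_def.1 hA
  refine Subalgebra.fg_def.2 ⟨⋃ i : ι, pullback K (fun x : ι → Y => x i) '' t,
    Set.finite_iUnion fun i => ht.image _, le_antisymm (Algebra.adjoin_le ?_)
      (Algebra.adjoin_le ?_)⟩
  · simp only [Set.iUnion_subset_iff, Set.image_subset_iff]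
    exact fun i f hf => coordinate_mem_powerRegular i (Algebra.subset_adjoin hf)
  · rintro _ ⟨i, f, hf, rfl⟩
    have : pullback K (fun x : ι → Y => x i) f ∈
        (Algebra.adjoin K t).map (pullback K (fun x : ι → Y => x i)) := ⟨f, hf, rfl⟩
    rw [AlgHom.map_adjoin] at this
    exact Algebra.adjoin_mono (Set.subset_iUnion_of_subset i subset_rfl) this

theorem hasPoints_powerRegular {A : Subalgebra K (Y → K)} (hA : IsAffineVariety A) :
    HasPoints (powerRegular ι A) := by
  intro χ
  let c (i : ι) : A →ₐ[K] powerRegular ι A :=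
    ((pullback K (fun x : ι → Y => x i)).comp A.val).codRestrict _
      fun f => coordinate_mem_powerRegular i f.2
  choose x hx using fun i => hA.bijective_eval.2 (χ.comp (c i))
  refine ⟨x, fun ⟨F, hF⟩ => ?_⟩
  induction hF using Algebra.adjoin_induction with
  | mem F hF =>
    obtain ⟨i, f, hf, rfl⟩ := hF
    exact (DFunLike.congr_fun (hx i) ⟨f, hf⟩).symm
  | algebraMap r => exact χ.commutes r
  | add F F' hF hF' h h' => exact (map_add χ ⟨F, hF⟩ ⟨F', hF'⟩).trans (congrArg₂ _ h h')
  | mul F F' hF hF' h h' => exact (map_mul χ ⟨F, hF⟩ ⟨F', hF'⟩).trans (congrArg₂ _ h h')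

theorem hasPoints_map_pullback {A : Subalgebra K (Y → K)} (hA : HasPoints A) {u : X → Y}
    (hu : IsClosed[zariski A] (Set.range u)) : HasPoints (A.map (pullback K u)) := by
  intro χ
  let r : A →ₐ[K] A.map (pullback K u) :=
    ((pullback K u).comp A.val).codRestrict _ fun f => ⟨f, f.2, rfl⟩
  obtain ⟨y, hy⟩ := hA (χ.comp r)
  have hyu : y ∈ Set.range u := by
    by_contra hne
    obtain ⟨f, hf, hfy, hf0⟩ := isClosed_zariski_iff.1 hu y hne
    refine hfy ((hy ⟨f, hf⟩).symm.trans ?_)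
    have : r ⟨f, hf⟩ = 0 := Subtype.ext (funext fun x => hf0 _ ⟨x, rfl⟩)
    rw [AlgHom.comp_apply, this, map_zero]
  obtain ⟨x, rfl⟩ := hyu
  refine ⟨x, ?_⟩
  rintro ⟨_, f, hf, rfl⟩
  exact hy ⟨f, hf⟩

theorem isClosed_singleton_zariski {A : Subalgebra K (X → K)} (hA : IsAffineVariety A) (x : X) :
    IsClosed[zariski A] {x} := by
  refine isClosed_zariski_iff.2 fun y hy => ?_
  have hne := hA.bijective_eval.1.ne hy
  obtain ⟨f, hf⟩ := DFunLike.ne_iff.1 hne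
  refine ⟨f - algebraMap K (X → K) ((f : X → K) x), sub_mem f.2 (A.algebraMap_mem _),
    sub_ne_zero.2 hf, ?_⟩
  rintro _ rfl
  exact sub_self _

theorem isClosed_of_finite_zariski {A : Subalgebra K (X → K)} (hA : IsAffineVariety A) {S : Set X}
    (hS : S.Finite) : IsClosed[zariski A] S := by
  let _ := zariski A
  rw [← Set.biUnion_of_singleton S]
  exact hS.isClosed_biUnion fun x _ => isClosed_singleton_zariski hA x

end Powers

/-! ### Morphisms to an affine algebraic group, and word maps. -/

section Morphisms

variable {K : Type*} [Field K] {X G : Type*} [Group G]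

/-- The group of morphisms from `X` to an affine algebraic group. -/
def morphisms (R : Subalgebra K (X → K)) (A : Subalgebra K (G → K)) [IsAffineAlgebraicGroup A] :
    Subgroup (X → G) where
  carrier := {u | ∀ f ∈ A, (fun x => f (u x)) ∈ R}
  one_mem' f _ := R.algebraMap_mem (f 1)
  mul_mem' := by
    intro u v hu hv f hf
    refine comp_mem_of_mem_powerRegular (u := fun x => ![u x, v x])
      (IsAffineAlgebraicGroup.mul_regular f hf) fun i f hf => ?_
    fin_cases i
    · exact hu f hf
    · exact hv f hf
  inv_mem' := fun hu f hf => hu _ (IsAffineAlgebraicGroup.inv_regular f hf)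

variable {R : Subalgebra K (X → K)} {A : Subalgebra K (G → K)} [IsAffineAlgebraicGroup A]

theorem const_mem_morphisms (g : G) : (fun _ => g) ∈ morphisms R A :=
  fun f _ => R.algebraMap_mem (f g)

theorem lift_mem_morphisms {ι : Type*} {u : ι → X → G} (hu : ∀ i, u i ∈ morphisms R A)
    (w : FreeGroup ι) : (fun x => FreeGroup.lift (fun i => u i x) w) ∈ morphisms R A := by
  have : (fun x => FreeGroup.lift (fun i => u i x) w) = FreeGroup.lift u w := by
    ext x
    have : FreeGroup.lift (fun i => u i x) =
        (Pi.evalMonoidHom (fun _ : X => G) x).comp (FreeGroup.lift u) := by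
      ext i
      simp
    rw [this]
    rfl
  rw [this]
  exact FreeGroup.range_lift_le (by rintro _ ⟨i, rfl⟩; exact hu i) ⟨w, rfl⟩

theorem continuous_of_mem_morphisms {u : X → G} (hu : u ∈ morphisms R A) :
    @Continuous X G (zariski R) (zariski A) u :=
  continuous_zariski hu

end Morphisms

/-! ### Regular functions on spaces of representations -/

section HomRegular

variable {K : Type*} [Field K] {G : Type*} [Group G] {Γ : Type*} [Group Γ] {N : ℕ}
  {s : Fin N → Γ} {A : Subalgebra K (G → K)}

theorem comp_mem_of_mem_homRegular {X : Type*} {R : Subalgebra K (X → K)} {F : (Γ →* G) → K}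
    (hF : F ∈ homRegular s A) {u : X → Γ →* G}
    (hu : ∀ i, ∀ f ∈ A, (fun x => f (u x (s i))) ∈ R) : (fun x => F (u x)) ∈ R := by
  obtain ⟨F, hF, rfl⟩ := hF
  exact comp_mem_of_mem_powerRegular (u := fun x i => u x (s i)) hF hu

theorem coordinate_mem_homRegular (i : Fin N) {f : G → K} (hf : f ∈ A) :
    (fun ρ : Γ →* G => f (ρ (s i))) ∈ homRegular s A :=
  ⟨_, coordinate_mem_powerRegular i hf, rfl⟩

theorem conj_mem_homRegular [IsAffineAlgebraicGroup A] (g : G) {F : (Γ →* G) → K}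
    (hF : F ∈ homRegular s A) : (fun ρ => F (conj g ρ)) ∈ homRegular s A := by
  refine comp_mem_of_mem_homRegular hF fun i f hf => ?_
  have : (fun _ => g) * (fun ρ : Γ →* G => ρ (s i)) * (fun _ => g)⁻¹ ∈
      morphisms (homRegular s A) A :=
    mul_mem (mul_mem (const_mem_morphisms g) fun f hf => coordinate_mem_homRegular i hf)
      (inv_mem (const_mem_morphisms g))
  exact this f hf

theorem project_mem_homRegular {H : Subgroup G} [H.Normal] {F : (Γ →* G ⧸ H) → K}
    (hF : F ∈ homRegular s (quotientGroupRegular A H)) :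
    (fun ρ => F (project H ρ)) ∈ homRegular s A :=
  comp_mem_of_mem_homRegular hF fun i f hf =>
    coordinate_mem_homRegular (f := fun g : G => f g) i hf

theorem one_mem_hom0 : (1 : Γ →* G) ∈ hom0 s A :=
  @mem_connectedComponent _ (zariski (homRegular s A)) 1

/-- A continuous map sends a component into a component, so a single point decides which one. -/
theorem image_hom0_subset {u : (Γ →* G) → (Γ →* G)}
    (hu : ∀ f ∈ homRegular s A, (fun ρ => f (u ρ)) ∈ homRegular s A)
    {ρ : Γ →* G} (hρ : ρ ∈ hom0 s A) (huρ : u ρ ∈ hom0 s A) : u '' hom0 s A ⊆ hom0 s A := by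
  let _ := zariski (homRegular s A)
  have hu' : Continuous u := continuous_zariski hu
  have h := (isPreconnected_connectedComponent.image u
    hu'.continuousOn).subset_connectedComponent ⟨ρ, hρ, rfl⟩
  rwa [← connectedComponent_eq (show u ρ ∈ connectedComponent 1 from huρ)] at h

theorem conj_one (g : G) : (conj g 1 : Γ →* G) = 1 := by
  ext γ
  simp [conj]

theorem conj_mem_hom0 [IsAffineAlgebraicGroup A] (g : G) {ρ : Γ →* G} (hρ : ρ ∈ hom0 s A) :
    conj g ρ ∈ hom0 s A :=
  image_hom0_subset (fun _ hf => conj_mem_homRegular g hf) one_mem_hom0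
    (by rw [conj_one]; exact one_mem_hom0) ⟨ρ, hρ, rfl⟩

theorem mem_hom'_of_smul_mem {H : Subgroup G} [IsCentralSubgroup H] [IsAffineAlgebraicGroup A]
    {σ : Γ →* H} {ρ : Γ →* G} (hρ : ρ ∈ hom0 s A) (hσ : σ • ρ ∈ hom0 s A) :
    σ ∈ hom' H s A := by
  rw [MulAction.mem_stabilizer_iff]
  refine subset_antisymm (image_hom0_subset (fun f hf => homRegular_smul s A σ hf) hρ hσ) ?_
  rw [Set.subset_smul_set_iff]
  exact image_hom0_subset (fun f hf => homRegular_smul s A σ⁻¹ hf) hσ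
    (by rwa [inv_smul_smul])

theorem monoidHom_ext_of_closure_eq_top {G : Type*} [Group G]
    (hs : Subgroup.closure (Set.range s) = ⊤) {ρ ρ' : Γ →* G}
    (h : ∀ i, ρ (s i) = ρ' (s i)) : ρ = ρ' :=
  MonoidHom.eq_of_eqOn_dense hs (by rintro _ ⟨i, rfl⟩; exact h i)

theorem finite_monoidHom {G : Type*} [Group G] [Finite G]
    (hs : Subgroup.closure (Set.range s) = ⊤) : Finite (Γ →* G) :=
  Finite.of_injective (fun (ρ : Γ →* G) (i : Fin N) => ρ (s i)) fun _ _ h =>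
    monoidHom_ext_of_closure_eq_top hs (congrFun h)

end HomRegular

/-! ### Tuples in `G` that define a representation in `G / H` -/

section Liftable

variable {K : Type*} [Field K] {G : Type*} [Group G] {Γ : Type*} [Group Γ] {N : ℕ}
  (s : Fin N → Γ) (A : Subalgebra K (G → K)) (H : Subgroup G) [IsCentralSubgroup H]

/-- The tuples in `G ^ N` whose image in `(G / H) ^ N` comes from a representation of `Γ`, with
the multiplication action of `H ^ N`. -/
def liftable : SubMulAction (Fin N → H) (Fin N → G) where
  carrier := {x | ∃ ρ : Γ →* G ⧸ H, ∀ i, ρ (s i) = (x i : G ⧸ H)}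
  smul_mem' := by
    rintro h x ⟨ρ, hρ⟩
    refine ⟨ρ, fun i => (hρ i).trans ?_⟩
    change ((x i : G) : G ⧸ H) = (((h i : G) * x i : G) : G ⧸ H)
    rw [← IsCentralSubgroup.comm H (h i) (x i), QuotientGroup.mk_mul_of_mem _ (h i).2]

/-- Regular functions on the tuples that define a representation in `G / H`. -/
def liftableRegular : Subalgebra K (liftable s H → K) :=
  (powerRegular (Fin N) A).map (pullback K (Subtype.val : liftable s H → Fin N → G))

/-- The representation in `G / H` defined by a tuple. -/
noncomputable def toQuotientHom (x : liftable s H) : Γ →* G ⧸ H := x.2.choose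

/-- The tuple of values of a representation on the generators. -/
def tupleOfHom (ρ : Γ →* G) : liftable s H := ⟨fun i => ρ (s i), project H ρ, fun _ => rfl⟩

variable {s H}

theorem toQuotientHom_apply (x : liftable s H) (i : Fin N) :
    toQuotientHom s H x (s i) = ((x : Fin N → G) i : G ⧸ H) := x.2.choose_spec i

theorem toQuotientHom_tupleOfHom (hs : Subgroup.closure (Set.range s) = ⊤) (ρ : Γ →* G) :
    toQuotientHom s H (tupleOfHom s H ρ) = project H ρ :=
  monoidHom_ext_of_closure_eq_top hs fun i => toQuotientHom_apply _ i

theorem toQuotientHom_surjective (hs : Subgroup.closure (Set.range s) = ⊤) :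
    Function.Surjective (toQuotientHom s H) := by
  intro ρ
  choose x hx using fun i => QuotientGroup.mk_surjective (ρ (s i))
  refine ⟨⟨x, ρ, fun i => (hx i).symm⟩, monoidHom_ext_of_closure_eq_top hs fun i => ?_⟩
  rw [toQuotientHom_apply, hx]

theorem toQuotientHom_eq_iff (hs : Subgroup.closure (Set.range s) = ⊤) (x y : liftable s H) :
    toQuotientHom s H x = toQuotientHom s H y ↔ ∃ h : Fin N → H, h • x = y := by
  constructor
  · intro h
    have key (i : Fin N) : (y : Fin N → G) i * ((x : Fin N → G) i)⁻¹ ∈ H := by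
      rw [← QuotientGroup.eq_one_iff, QuotientGroup.mk_mul, QuotientGroup.mk_inv,
        ← toQuotientHom_apply, ← toQuotientHom_apply, h, mul_inv_cancel]
    refine ⟨fun i => ⟨_, key i⟩, Subtype.ext (funext fun i => ?_)⟩
    exact inv_mul_cancel_right _ _
  · rintro ⟨h, rfl⟩
    refine monoidHom_ext_of_closure_eq_top hs fun i => ?_
    rw [toQuotientHom_apply, toQuotientHom_apply]
    change _ = (((h i : G) * (x : Fin N → G) i : G) : G ⧸ H)
    rw [← IsCentralSubgroup.comm H (h i), QuotientGroup.mk_mul_of_mem _ (h i).2]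

theorem lift_mem_of_mem_liftable {x : Fin N → G} (hx : x ∈ liftable s H) {r : FreeGroup (Fin N)}
    (hr : r ∈ (FreeGroup.lift s).ker) : FreeGroup.lift x r ∈ H := by
  obtain ⟨ρ, hρ⟩ := hx
  have : (QuotientGroup.mk' H).comp (FreeGroup.lift x) = ρ.comp (FreeGroup.lift s) := by
    ext i
    simp [hρ]
  rw [← QuotientGroup.eq_one_iff]
  refine (DFunLike.congr_fun this r).trans ?_
  rw [MonoidHom.comp_apply, MonoidHom.mem_ker.1 hr, map_one]

theorem exists_monoidHom_of_lift_ker {G : Type*} [Group G]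
    (hs : Subgroup.closure (Set.range s) = ⊤) {x : Fin N → G}
    (h : (FreeGroup.lift s).ker ≤ (FreeGroup.lift x).ker) : ∃ ρ : Γ →* G, ∀ i, ρ (s i) = x i := by
  refine ⟨MonoidHom.liftOfSurjective _ (FreeGroup.lift_surjective_iff_closure_range_eq_top.2 hs) ⟨_, h⟩, fun i => ?_⟩
  have := MonoidHom.liftOfRightInverse_comp_apply (FreeGroup.lift s) _
    (Function.rightInverse_surjInv (FreeGroup.lift_surjective_iff_closure_range_eq_top.2 hs)) ⟨_, h⟩ (FreeGroup.of i)
  simpa using this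

/-- Only the relators matter: this makes liftability a family of closed conditions, since `H` is
finite and word maps are continuous. -/
theorem mem_liftable_iff (hs : Subgroup.closure (Set.range s) = ⊤) {x : Fin N → G} :
    x ∈ liftable s H ↔ ∀ r ∈ (FreeGroup.lift s).ker, FreeGroup.lift x r ∈ H := by
  refine ⟨fun hx r hr => lift_mem_of_mem_liftable hx hr, fun h =>
    exists_monoidHom_of_lift_ker hs fun r hr => ?_⟩
  have : FreeGroup.lift (fun i => (x i : G ⧸ H)) =
      (QuotientGroup.mk' H).comp (FreeGroup.lift x) := by
    ext i
    simp
  rw [MonoidHom.mem_ker, this]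
  exact (QuotientGroup.eq_one_iff _).2 (h r hr)

variable {A}

theorem smul_mem_liftableRegular [IsAffineAlgebraicGroup A] (h : Fin N → H)
    {F : liftable s H → K} (hF : F ∈ liftableRegular s A H) :
    (fun x => F (h • x)) ∈ liftableRegular s A H := by
  obtain ⟨F, hF, rfl⟩ := hF
  refine comp_mem_of_mem_powerRegular (u := fun x : liftable s H => (h • x : liftable s H).1) hF
    fun i f hf => ?_
  exact ⟨_, coordinate_mem_powerRegular i (mul_left_regular A (h i : G) hf), rfl⟩

theorem liftableRegular_fg [IsAffineAlgebraicGroup A] : (liftableRegular s A H).FG :=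
  (powerRegular_fg (IsAffineAlgebraicGroup.affine (A := A)).fg).map _

theorem isClosed_liftable [IsAffineAlgebraicGroup A] [Finite H]
    (hs : Subgroup.closure (Set.range s) = ⊤) :
    IsClosed[zariski (powerRegular (Fin N) A)] (liftable s H : Set (Fin N → G)) := by
  let _ := zariski (powerRegular (Fin N) A)
  let _ := zariski A
  have : (liftable s H : Set (Fin N → G)) =
      ⋂ r ∈ (FreeGroup.lift s).ker, (fun x => FreeGroup.lift x r) ⁻¹' (H : Set G) := by
    ext x
    simp only [SetLike.mem_coe, mem_liftable_iff hs, Set.mem_iInter, Set.mem_preimage]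
  rw [this]
  have hH : IsClosed (H : Set G) :=
    isClosed_of_finite_zariski IsAffineAlgebraicGroup.affine (Set.toFinite _)
  exact isClosed_biInter fun r _ => hH.preimage (continuous_of_mem_morphisms
    (lift_mem_morphisms (u := fun i (x : Fin N → G) => x i) (fun i f hf => coordinate_mem_powerRegular i hf) r))

theorem hasPoints_liftableRegular [IsAffineAlgebraicGroup A] [Finite H]
    (hs : Subgroup.closure (Set.range s) = ⊤) : HasPoints (liftableRegular s A H) :=
  hasPoints_map_pullback (hasPoints_powerRegular IsAffineAlgebraicGroup.affine)
    (by rw [Subtype.range_coe]; exact isClosed_liftable hs)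

theorem homRegular_eq_map :
    homRegular s A = (liftableRegular s A H).map (pullback K (tupleOfHom s H)) := by
  rw [liftableRegular, Subalgebra.map_map]
  rfl

/-- On liftable tuples each relator takes values in the finite set `H`, so its fibre over `1` is
clopen. Hence every relator is trivial on the component of the trivial tuple, and that component
consists of representations into `G`. -/
theorem image_tupleOfHom_hom0 [IsAffineAlgebraicGroup A] [Finite H]
    (hs : Subgroup.closure (Set.range s) = ⊤) :
    tupleOfHom s H '' hom0 s A =
      @connectedComponent _ (zariski (liftableRegular s A H)) (tupleOfHom s H 1) := by
  let _ := zariski (liftableRegular s A H)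
  let _ := zariski (homRegular s A)
  let _ := zariski A
  have hind : Topology.IsInducing (tupleOfHom s H) :=
    ⟨(congrArg zariski homRegular_eq_map).trans (zariski_map_pullback _ _)⟩
  have hrange : connectedComponent (tupleOfHom s H 1) ⊆ Set.range (tupleOfHom s H) := by
    intro x hx
    have hker : (FreeGroup.lift s).ker ≤ (FreeGroup.lift (x : Fin N → G)).ker := by
      intro r hr
      let w : liftable s H → G := fun y => FreeGroup.lift (y : Fin N → G) r
      have hw : Continuous w := continuous_of_mem_morphisms (R := liftableRegular s A H)
        (lift_mem_morphisms (R := liftableRegular s A H)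
          (u := fun i (x : liftable s H) => (x : Fin N → G) i)
          (fun i f hf => ⟨fun x => f (x i), coordinate_mem_powerRegular i hf, rfl⟩) r)
      have hfin (S : Set G) (hS : S ⊆ H) : IsClosed (w ⁻¹' S) :=
        (isClosed_of_finite_zariski IsAffineAlgebraicGroup.affine
          ((Set.toFinite (H : Set G)).subset hS)).preimage hw
      have hopen : IsOpen (w ⁻¹' {1}) := by
        have : w ⁻¹' {1} = (w ⁻¹' ((H : Set G) \ {1}))ᶜ := by
          ext y
          have : w y ∈ H := lift_mem_of_mem_liftable y.2 hr
          simp [this]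
        rw [this]
        exact (hfin _ Set.sdiff_subset).isOpen_compl
      have h1 : tupleOfHom s H 1 ∈ w ⁻¹' {1} := by
        have : FreeGroup.lift (fun _ : Fin N => (1 : G)) = 1 := by ext; simp
        exact DFunLike.congr_fun this r
      exact IsClopen.connectedComponent_subset
        ⟨hfin _ (Set.singleton_subset_iff.2 (one_mem H)), hopen⟩ h1 hx
    obtain ⟨ρ, hρ⟩ := exists_monoidHom_of_lift_ker hs hker
    exact ⟨ρ, Subtype.ext (funext hρ)⟩
  refine subset_antisymm ?_ fun x hx => ?_
  · exact (isPreconnected_connectedComponent.image _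
      hind.continuous.continuousOn).subset_connectedComponent ⟨1, mem_connectedComponent, rfl⟩
  · obtain ⟨ρ, rfl⟩ := hrange hx
    have hpre : IsPreconnected (tupleOfHom s H ⁻¹' connectedComponent (tupleOfHom s H 1)) := by
      rw [← hind.isPreconnected_image, Set.image_preimage_eq_of_subset hrange]
      exact isPreconnected_connectedComponent
    exact ⟨ρ, hpre.subset_connectedComponent mem_connectedComponent hx, rfl⟩

end Liftable

/-! ### Averaging over `H ^ N` -/

section Average

variable {K : Type*} [Field K] {G : Type*} [Group G] {Γ : Type*} [Group Γ] {N : ℕ}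
  {s : Fin N → Γ} {A : Subalgebra K (G → K)} {H : Subgroup G} [IsCentralSubgroup H]

/-- On a product $\prod_i f_i(x_i)$ the sum over $H^N$ factors into sums over $H$, one in each
coordinate; this reduces averaging to $N=1$. -/
theorem mem_span_of_mem_powerRegular {ι Y : Type*} [Fintype ι] {A : Subalgebra K (Y → K)}
    {F : (ι → Y) → K} (hF : F ∈ powerRegular ι A) :
    F ∈ Submodule.span K
      {F : (ι → Y) → K | ∃ f : ι → Y → K, (∀ i, f i ∈ A) ∧ F = fun x => ∏ i, f i (x i)} := by
  classical
  rw [powerRegular, ← Subalgebra.mem_toSubmodule, Algebra.adjoin_eq_span] at hF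
  refine Submodule.span_mono (fun F hF => ?_) hF
  induction hF using Submonoid.closure_induction with
  | mem F hF =>
    obtain ⟨i, f, hf, rfl⟩ := hF
    refine ⟨Function.update 1 i f, fun j => ?_, funext fun x => ?_⟩
    · obtain rfl | hj := eq_or_ne j i
      · rwa [Function.update_self]
      · rw [Function.update_of_ne hj]
        exact one_mem A
    · rw [Finset.prod_eq_single i (fun j _ hj => by simp [hj]) (by simp)]
      simp
  | one => exact ⟨1, fun _ => one_mem A, by ext; simp⟩
  | mul F F' _ _ hF hF' =>
    obtain ⟨f, hf, rfl⟩ := hF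
    obtain ⟨f', hf', rfl⟩ := hF'
    exact ⟨f * f', fun i => mul_mem (hf i) (hf' i), by
      ext x; simp [Finset.prod_mul_distrib]⟩

theorem exists_quotientGroupRegular_sum [IsAffineAlgebraicGroup A] [Fintype H] {f : G → K}
    (hf : f ∈ A) : ∃ g ∈ quotientGroupRegular A H, ∀ a : G, g a = ∑ h : H, f (h * a) := by
  have key (a : G) :
      ∑ h : H, f (h * (Quotient.out (a : G ⧸ H))) = ∑ h : H, f (h * a) := by
    obtain ⟨k, hk⟩ := QuotientGroup.mk_out_eq_mul H a
    refine Fintype.sum_equiv (Equiv.mulRight k) _ _ fun h => ?_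
    rw [hk, IsCentralSubgroup.comm H k a, Equiv.coe_mulRight, Subgroup.coe_mul, mul_assoc]
  refine ⟨fun y => ∑ h : H, f (h * Quotient.out y), ?_, key⟩
  have h : ∑ h : H, (fun a => f (h * a)) ∈ A :=
    sum_mem fun h _ => mul_left_regular A (h : G) hf
  have heq : (fun y : G ⧸ H => ∑ h : H, f (h * Quotient.out y)) ∘ (fun g : G => (g : G ⧸ H)) =
      ∑ h : H, (fun a => f (h * a)) := by
    ext a
    rw [Finset.sum_apply]
    exact key a
  rw [← heq] at h
  exact h

theorem exists_powerRegular_sum [IsAffineAlgebraicGroup A] [Fintype H] {F : (Fin N → G) → K}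
    (hF : F ∈ powerRegular (Fin N) A) :
    ∃ F' ∈ powerRegular (Fin N) (quotientGroupRegular A H), ∀ x : Fin N → G,
      F' (fun i => (x i : G ⧸ H)) = ∑ h : Fin N → H, F (h • x) := by
  replace hF := mem_span_of_mem_powerRegular hF
  induction hF using Submodule.span_induction with
  | mem F hF =>
    obtain ⟨f, hf, rfl⟩ := hF
    choose g hg hgf using fun i => exists_quotientGroupRegular_sum (H := H) (hf i)
    have h : ∏ i, (fun y : Fin N → G ⧸ H => g i (y i)) ∈
        powerRegular (Fin N) (quotientGroupRegular A H) :=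
      prod_mem fun i _ => coordinate_mem_powerRegular i (hg i)
    refine ⟨_, h, fun x => ?_⟩
    simp only [Finset.prod_apply, hgf]
    rw [Fintype.prod_sum]
    rfl
  | zero => exact ⟨0, zero_mem _, fun x => by simp⟩
  | add F₁ F₂ h₁ h₂ ih₁ ih₂ =>
    obtain ⟨F₁', hF₁, h₁⟩ := ih₁
    obtain ⟨F₂', hF₂, h₂⟩ := ih₂
    exact ⟨F₁' + F₂', add_mem hF₁ hF₂, fun x => by
      simp only [Pi.add_apply, h₁, h₂, Finset.sum_add_distrib]⟩
  | smul c F _ ih =>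
    obtain ⟨F', hF', h⟩ := ih
    exact ⟨c • F', Subalgebra.smul_mem _ hF' c, fun x => by
      simp only [Pi.smul_apply, h, Finset.smul_sum]⟩

theorem mem_homRegular_quotientGroupRegular_iff [IsAffineAlgebraicGroup A] [Finite H]
    (hcard : (Nat.card H : K) ≠ 0) (hs : Subgroup.closure (Set.range s) = ⊤)
    {f : (Γ →* G ⧸ H) → K} :
    f ∈ homRegular s (quotientGroupRegular A H) ↔
      (fun x => f (toQuotientHom s H x)) ∈ liftableRegular s A H := by
  have := Fintype.ofFinite H
  constructor
  · intro hf
    refine comp_mem_of_mem_homRegular hf fun i a ha => ?_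
    simp only [toQuotientHom_apply]
    exact ⟨fun x => a (x i), coordinate_mem_powerRegular (f := fun g : G => a g) i ha, rfl⟩
  · rintro ⟨F, hF, hFf⟩
    obtain ⟨F', hF', h⟩ := exists_powerRegular_sum (H := H) hF
    -- The sum over $H^N$ multiplies an invariant function by $|H|^N$, which must be inverted.
    have hN : (Fintype.card (Fin N → H) : K) ≠ 0 := by
      rw [Fintype.card_fun, ← Nat.card_eq_fintype_card, Nat.cast_pow]
      exact pow_ne_zero _ hcard
    refine ⟨(Fintype.card (Fin N → H) : K)⁻¹ • F', Subalgebra.smul_mem _ hF' _, funext fun ρ => ?_⟩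
    obtain ⟨x, rfl⟩ := toQuotientHom_surjective (H := H) hs ρ
    have hx (h : Fin N → H) : F (h • (x : Fin N → G)) = f (toQuotientHom s H x) := by
      rw [(toQuotientHom_eq_iff hs x (h • x)).2 ⟨h, rfl⟩]
      exact congrFun hFf (h • x)
    change (Fintype.card (Fin N → H) : K)⁻¹ * F' (fun i => toQuotientHom s H x (s i)) = _
    simp only [toQuotientHom_apply, h, hx, Finset.sum_const, Finset.card_univ, nsmul_eq_mul]
    exact inv_mul_cancel_left₀ hN _

end Average

/-! ### Lifting points along integral extensions. -/

section Integral

/-- Lying over gives a prime `Q` of `B` above the kernel of `χ`. The domain `B ⧸ Q` is integral over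
the algebraically closed field `K`, hence equal to it. -/
theorem exists_algHom_comp_eq {K C B : Type*} [Field K] [IsAlgClosed K] [CommRing C] [CommRing B]
    [Algebra K C] [Algebra K B] [Algebra C B] [IsScalarTower K C B] [Algebra.IsIntegral C B]
    (hinj : Function.Injective (algebraMap C B)) (χ : C →ₐ[K] K) :
    ∃ χ' : B →ₐ[K] K, ∀ c, χ' (algebraMap C B c) = χ c := by
  have hprime : (RingHom.ker χ).IsPrime := RingHom.ker_isPrime _
  obtain ⟨Q, -, hQ, hQP⟩ := Ideal.exists_ideal_over_prime_of_isIntegral (RingHom.ker χ)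
    (⊥ : Ideal B) (fun c hc => by
      have hc0 : c = 0 := hinj (hc.trans (map_zero _).symm)
      rw [hc0]
      exact zero_mem _)
  have hmk (c : C) : Ideal.Quotient.mk Q (algebraMap C B c) = algebraMap K (B ⧸ Q) (χ c) := by
    have hc : c - algebraMap K C (χ c) ∈ Q.comap (algebraMap C B) := by
      rw [hQP, RingHom.mem_ker, map_sub, AlgHom.commutes]
      exact sub_self _
    rw [Ideal.mem_comap, map_sub, ← IsScalarTower.algebraMap_apply] at hc
    exact Ideal.Quotient.eq.2 hc
  have hint : Algebra.IsIntegral K (B ⧸ Q) := by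
    refine ⟨fun y => ?_⟩
    obtain ⟨b, rfl⟩ := Ideal.Quotient.mk_surjective y
    obtain ⟨p, hp, hpb⟩ := Algebra.IsIntegral.isIntegral (R := C) b
    refine ⟨p.map χ, hp.map _, ?_⟩
    have hcomp : (algebraMap K (B ⧸ Q)).comp (χ : C →+* K) =
        (Ideal.Quotient.mk Q).comp (algebraMap C B) := RingHom.ext fun c => (hmk c).symm
    rw [Polynomial.eval₂_map, hcomp, ← Polynomial.hom_eval₂, hpb, map_zero]
  let e := AlgEquiv.ofBijective (Algebra.ofId K (B ⧸ Q))
    (IsAlgClosed.algebraMap_bijective_of_isIntegral (k := K) (K := B ⧸ Q))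
  refine ⟨(e.symm : (B ⧸ Q) →ₐ[K] K).comp (Ideal.Quotient.mkₐ K Q), fun c => ?_⟩
  rw [AlgHom.comp_apply, Ideal.Quotient.mkₐ_eq_mk, hmk]
  exact AlgHom.commutes _ _

theorem exists_algHom_comp_eq_of_invariants {K C B M : Type*} [Field K] [IsAlgClosed K]
    [CommRing C] [CommRing B] [Algebra K C] [Algebra K B] [Group M] [Finite M]
    [MulSemiringAction M B] (ι : C →ₐ[K] B) (hinj : Function.Injective ι)
    (hfix : ∀ (m : M) c, m • ι c = ι c) (hinv : ∀ b, (∀ m : M, m • b = b) → ∃ c, ι c = b)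
    (χ : C →ₐ[K] K) : ∃ χ' : B →ₐ[K] K, ∀ c, χ' (ι c) = χ c := by
  let _ : Algebra C B := ι.toRingHom.toAlgebra
  have : IsScalarTower K C B := IsScalarTower.of_algebraMap_eq fun r => (ι.commutes r).symm
  have : SMulCommClass M C B := ⟨fun m c b => by
    rw [Algebra.smul_def, Algebra.smul_def, smul_mul']
    exact congrArg (· * m • b) (hfix m c)⟩
  have : Algebra.IsInvariant C B M := ⟨hinv⟩
  have := Algebra.IsInvariant.isIntegral C B M
  exact exists_algHom_comp_eq hinj χ

end Integral

/-! ### The projection to representations in `G / H` -/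

section Project

variable {K : Type*} [Field K] {G : Type*} [Group G] {Γ : Type*} [Group Γ] {N : ℕ}
  {s : Fin N → Γ} {A : Subalgebra K (G → K)} {H : Subgroup G} [IsCentralSubgroup H]

theorem project_smul (σ : Γ →* H) (ρ : Γ →* G) : project H (σ • ρ) = project H ρ := by
  ext γ
  change (((σ γ : G) * ρ γ : G) : G ⧸ H) = (ρ γ : G ⧸ H)
  rw [← IsCentralSubgroup.comm H (σ γ), QuotientGroup.mk_mul_of_mem _ (σ γ).2]

theorem project_conj (g : G) (ρ : Γ →* G) :
    project H (conj g ρ) = conj (g : G ⧸ H) (project H ρ) := by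
  ext γ
  simp [project, conj]

theorem exists_smul_eq_of_project_eq {ρ ρ' : Γ →* G} (h : project H ρ = project H ρ') :
    ∃ σ : Γ →* H, σ • ρ = ρ' := by
  have key (γ : Γ) : ρ' γ * (ρ γ)⁻¹ ∈ H := by
    rw [← QuotientGroup.eq_one_iff, QuotientGroup.mk_mul, QuotientGroup.mk_inv]
    exact mul_inv_eq_one.2 (DFunLike.congr_fun h γ).symm
  -- The quotient $\rho'(\gamma)\rho(\gamma)^{-1}$ is multiplicative in $\gamma$ because its values
  -- are central.
  refine ⟨⟨⟨fun γ => ⟨_, key γ⟩, by simp⟩, fun a b => Subtype.ext ?_⟩, ?_⟩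
  · have hc := IsCentralSubgroup.comm H ⟨_, key b⟩ (ρ a)⁻¹
    simp only [map_mul, mul_inv_rev, Subgroup.coe_mul] at hc ⊢
    rw [mul_assoc (ρ' a) (ρ a)⁻¹, hc]
    simp only [mul_assoc]
  · ext γ
    exact inv_mul_cancel_right _ _

variable (A) in
theorem project_image_hom0 [IsAffineAlgebraicGroup A] [Finite H] (hcard : (Nat.card H : K) ≠ 0)
    (hs : Subgroup.closure (Set.range s) = ⊤) :
    project H '' hom0 s A = hom0 s (quotientGroupRegular A H) := by
  have hreg : quotientRegular (liftableRegular s A H) (toQuotientHom s H) =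
      homRegular s (quotientGroupRegular A H) :=
    Subalgebra.ext fun f => (mem_homRegular_quotientGroupRegular_iff hcard hs).symm
  have h1 : toQuotientHom s H (tupleOfHom s H 1) = 1 := toQuotientHom_tupleOfHom hs 1
  have := image_connectedComponent_quotient (A := liftableRegular s A H) liftableRegular_fg
    (fun h f hf => smul_mem_liftableRegular h hf) (toQuotientHom_eq_iff hs)
    (toQuotientHom_surjective hs) (tupleOfHom s H 1)
  rw [← image_tupleOfHom_hom0 hs, Set.image_image, hreg, h1] at this
  simp only [toQuotientHom_tupleOfHom hs] at this
  exact this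

theorem project_mem_hom0 [IsAffineAlgebraicGroup A] [Finite H] (hcard : (Nat.card H : K) ≠ 0)
    (hs : Subgroup.closure (Set.range s) = ⊤) {ρ : Γ →* G} (hρ : ρ ∈ hom0 s A) :
    project H ρ ∈ hom0 s (quotientGroupRegular A H) :=
  project_image_hom0 A hcard hs ▸ ⟨ρ, hρ, rfl⟩

/-- The function is extended by zero off $\mathrm{Hom}^0$, so that it is regular on all of
$\mathrm{Hom}(\Gamma,G/H)$ and, later, conjugation invariant everywhere. -/
theorem exists_homRegular_descent [IsAlgClosed K] [IsAffineAlgebraicGroup A] [Finite H]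
    (hcard : (Nat.card H : K) ≠ 0)
    (hs : Subgroup.closure (Set.range s) = ⊤) {F : (Γ →* G) → K} (hF : F ∈ homRegular s A)
    (hinv : ∀ σ ∈ hom' H s A, ∀ ρ ∈ hom0 s A, F (σ • ρ) = F ρ) :
    ∃ f ∈ homRegular s (quotientGroupRegular A H), (∀ ρ ∈ hom0 s A, f (project H ρ) = F ρ) ∧
      ∀ z ∉ hom0 s (quotientGroupRegular A H), f z = 0 := by
  classical
  let f (z : Γ →* G ⧸ H) : K := if h : ∃ ρ ∈ hom0 s A, project H ρ = z then F h.choose else 0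
  have hf (ρ : Γ →* G) (hρ : ρ ∈ hom0 s A) : f (project H ρ) = F ρ := by
    have h : ∃ ρ' ∈ hom0 s A, project H ρ' = project H ρ := ⟨ρ, hρ, rfl⟩
    obtain ⟨σ, hσ⟩ := exists_smul_eq_of_project_eq h.choose_spec.2
    simp only [f, dif_pos h]
    -- The chosen lift and `ρ` differ by some `σ` which lies in `hom'`, so the choice does not
    -- matter.
    rw [← hinv σ (mem_hom'_of_smul_mem h.choose_spec.1 (hσ.symm ▸ hρ)) _ h.choose_spec.1, hσ]
  have hf0 (z) (hz : z ∉ hom0 s (quotientGroupRegular A H)) : f z = 0 := by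
    rw [← project_image_hom0 A hcard hs] at hz
    exact dif_neg hz
  refine ⟨f, (mem_homRegular_quotientGroupRegular_iff hcard hs).2 ?_, hf, hf0⟩
  rw [homRegular_eq_map (H := H)] at hF
  obtain ⟨F, hF, rfl⟩ := hF
  let _ := zariski (liftableRegular s A H)
  have := noetherianSpace_zariski (liftableRegular_fg (s := s) (A := A) (H := H))
  have himage := image_tupleOfHom_hom0 (A := A) (H := H) hs
  refine mem_of_regular_on_isClopen (fun h f hf => smul_mem_liftableRegular h hf)
    (indicator_mem_of_isClopen liftableRegular_fg (hasPoints_liftableRegular hs)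
      (isClopen_connectedComponent_of_noetherianSpace (tupleOfHom s H 1))) hF
    (fun h x => ?_) (fun x hx => ?_) (fun x hx => hf0 _ fun hmem => ?_)
  · rw [(toQuotientHom_eq_iff hs x (h • x)).2 ⟨h, rfl⟩]
  · rw [← himage] at hx
    obtain ⟨ρ, hρ, rfl⟩ := hx
    rw [toQuotientHom_tupleOfHom hs, hf ρ hρ]
    rfl
  · rw [← project_image_hom0 A hcard hs] at hmem
    obtain ⟨ρ, hρ, hρx⟩ := hmem
    rw [← toQuotientHom_tupleOfHom hs, eq_comm, toQuotientHom_eq_iff hs] at hρx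
    obtain ⟨h, hh⟩ := hρx
    refine hx h ?_
    rw [hh, ← himage]
    exact ⟨ρ, hρ, rfl⟩

theorem exists_invariants_descent [IsAlgClosed K] [IsAffineAlgebraicGroup A] [Finite H]
    (hcard : (Nat.card H : K) ≠ 0)
    (hs : Subgroup.closure (Set.range s) = ⊤) {F : (Γ →* G) → K} (hF : F ∈ invariants s A)
    (hinv : ∀ σ ∈ hom' H s A, ∀ ρ ∈ hom0 s A, F (σ • ρ) = F ρ) :
    ∃ f ∈ invariants s (quotientGroupRegular A H), ∀ ρ ∈ hom0 s A, f (project H ρ) = F ρ := by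
  obtain ⟨f, hf, hfF, hf0⟩ := exists_homRegular_descent hcard hs hF.1 hinv
  refine ⟨f, ⟨hf, fun g z => ?_⟩, hfF⟩
  obtain ⟨g, rfl⟩ := QuotientGroup.mk_surjective g
  by_cases hz : z ∈ hom0 s (quotientGroupRegular A H)
  · rw [← project_image_hom0 A hcard hs] at hz
    obtain ⟨ρ, hρ, rfl⟩ := hz
    rw [← project_conj, hfF _ (conj_mem_hom0 g hρ), hfF _ hρ, hF.2]
  · rw [hf0 z hz, hf0]
    -- Conjugation by `g` cannot move `z` into $\mathrm{Hom}^0$, since conjugating back by `g⁻¹`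
    -- preserves it.
    contrapose! hz
    rw [← project_image_hom0 A hcard hs] at hz ⊢
    obtain ⟨ρ, hρ, hρz⟩ := hz
    refine ⟨conj g⁻¹ ρ, conj_mem_hom0 _ hρ, ?_⟩
    rw [project_conj, hρz]
    ext γ
    simp [conj, mul_assoc]

end Project

/-! ### Character varieties -/

section OrbitSpace

variable {K : Type*} [Field K] {X Y M : Type*} [Group M] [MulAction M X]

theorem exists_isIsomorphism_orbitRegular {A : Subalgebra K (X → K)} {B : Subalgebra K (Y → K)}
    {p : X → Y} (hp : ∀ x y, p x = p y ↔ ∃ m : M, m • x = y) (hsurj : Function.Surjective p)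
    (hreg : ∀ f : Y → K, f ∈ B ↔ (fun x => f (p x)) ∈ A) :
    ∃ φ : MulAction.orbitRel.Quotient M X → Y, (∀ x, φ (Quotient.mk _ x) = p x) ∧
      IsIsomorphism (orbitRegular M A) B φ := by
  refine ⟨Quotient.lift p fun x y ⟨m, hm⟩ => ((hp y x).2 ⟨m, hm⟩).symm, fun _ => rfl,
    ⟨?_, fun y => ?_⟩, hreg⟩
  · rintro ⟨x⟩ ⟨y⟩ h
    obtain ⟨m, hm⟩ := (hp y x).1 (Eq.symm h)
    exact Quotient.sound ⟨m, hm⟩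
  · obtain ⟨x, rfl⟩ := hsurj y
    exact ⟨Quotient.mk _ x, rfl⟩

end OrbitSpace

section CharVar

variable {K : Type*} [Field K] {G : Type*} [Group G] {Γ : Type*} [Group Γ] {N : ℕ}
  (s : Fin N → Γ) (A : Subalgebra K (G → K)) (H : Subgroup G) [IsCentralSubgroup H]

variable {s A} in
/-- Evaluation of invariant functions at a point of the character variety. -/
def evalChar (x : CharVar s A) : invariants s A →ₐ[K] K := x

/-- Pullback of invariant functions along the projection `G → G / H`. -/
def invariantsProject : invariants s (quotientGroupRegular A H) →ₐ[K] invariants s A where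
  toFun f := ⟨fun ρ => (f : (Γ →* G ⧸ H) → K) (project H ρ), project_mem_homRegular f.2.1,
    fun g ρ => (congrArg f.1 (project_conj g ρ)).trans (f.2.2 _ _)⟩
  map_one' := rfl
  map_mul' _ _ := rfl
  map_zero' := rfl
  map_add' _ _ := rfl
  commutes' _ := rfl

/-- The map `X_G(Γ) → X_{G / H}(Γ)` induced by the projection `G → G / H`. -/
def charProject (x : CharVar s A) : CharVar s (quotientGroupRegular A H) :=
  (evalChar x).comp (invariantsProject s A H)

variable {s A H}

theorem charVar_ext {x y : CharVar s A} (h : ∀ b, evalChar x b = evalChar y b) : x = y :=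
  AlgHom.ext h

theorem mem_charRegular_iff {f : CharVar s A → K} :
    f ∈ charRegular s A ↔ ∃ b, ∀ x, f x = evalChar x b :=
  ⟨fun ⟨b, hb⟩ => ⟨b, fun x => (congrFun hb x).symm⟩, fun ⟨b, hb⟩ => ⟨b, funext fun x => (hb x).symm⟩⟩

theorem mem_char0Regular_iff {f : char0 s A → K} :
    f ∈ char0Regular s A ↔
      ∃ F ∈ invariants s A, ∀ ρ : hom0 s A, f (toChar0 s A ρ) = F (ρ : Γ →* G) := by
  constructor
  · rintro ⟨g, hg, rfl⟩
    obtain ⟨b, hb⟩ := mem_charRegular_iff.1 hg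
    exact ⟨b, b.2, fun ρ => hb _⟩
  · rintro ⟨F, hF, h⟩
    refine ⟨fun x => evalChar x ⟨F, hF⟩, mem_charRegular_iff.2 ⟨_, fun _ => rfl⟩, ?_⟩
    ext ⟨_, ρ, hρ, rfl⟩
    exact (h ⟨ρ, hρ⟩).symm

variable (s A H) in
/-- The action of `Hom(Γ, H)` on the invariant functions. -/
abbrev invariantsAction [IsAffineAlgebraicGroup A] :
    MulSemiringAction (Γ →* H) (invariants s A) where
  smul σ b := invariantsSMul s A σ b
  one_smul b := Subtype.ext (funext fun ρ => congrArg b.1 (one_smul (Γ →* H) ρ))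
  -- Precomposition is a right action; it is a left action here because `Γ →* H` is commutative.
  mul_smul σ τ b := Subtype.ext (funext fun ρ => congrArg b.1
    ((congrArg (· • ρ) (mul_comm σ τ)).trans (mul_smul τ σ ρ)))
  smul_zero σ := map_zero (invariantsSMul s A σ)
  smul_add σ := map_add (invariantsSMul s A σ)
  smul_one σ := map_one (invariantsSMul s A σ)
  smul_mul σ := map_mul (invariantsSMul s A σ)

theorem charProject_smul [IsAffineAlgebraicGroup A] (σ : Γ →* H) (x : CharVar s A) :
    charProject s A H (σ • x) = charProject s A H x := by
  refine charVar_ext fun b => congrArg (evalChar x) (Subtype.ext (funext fun ρ => ?_))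
  exact congrArg (b : (Γ →* G ⧸ H) → K) (project_smul σ ρ)

variable [IsAffineAlgebraicGroup A] [Finite H]

theorem charProject_mem_char0 (hcard : (Nat.card H : K) ≠ 0)
    (hs : Subgroup.closure (Set.range s) = ⊤) {x : CharVar s A} (hx : x ∈ char0 s A) :
    charProject s A H x ∈ char0 s (quotientGroupRegular A H) := by
  obtain ⟨ρ, hρ, rfl⟩ := hx
  exact ⟨project H ρ, project_mem_hom0 hcard hs hρ, rfl⟩

variable [IsAlgClosed K]

/-- Apply orbit separation to `hom'` acting on `hom0` with the restricted conjugation invariants as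
functions. Those that are also `hom'`-invariant come from $G/H$, where the two characters agree. -/
theorem exists_smul_toChar_eq (hcard : (Nat.card H : K) ≠ 0)
    (hs : Subgroup.closure (Set.range s) = ⊤) {ρ ρ' : hom0 s A}
    (h : toChar s (quotientGroupRegular A H) (project H (ρ : Γ →* G)) =
      toChar s (quotientGroupRegular A H) (project H (ρ' : Γ →* G))) :
    ∃ σ : hom' H s A, toChar s A ((σ : Γ →* H) • (ρ : Γ →* G)) = toChar s A ρ' := by
  have := finite_monoidHom (G := H) hs
  have hM (σ : hom' H s A) : ∀ f ∈ restrictRegular (invariants s A) (hom0 s A),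
      (fun ρ => f (σ • ρ)) ∈ restrictRegular (invariants s A) (hom0 s A) := by
    rintro _ ⟨F, hF, rfl⟩
    exact ⟨_, (invariantsSMul s A (σ : Γ →* H) ⟨F, hF⟩).2, rfl⟩
  obtain ⟨σ, hσ⟩ := exists_smul_of_invariants_eq hM (x := ρ) (y := ρ') (by
    rintro _ ⟨F, hF, rfl⟩ hinv
    obtain ⟨f, hf, hfF⟩ := exists_invariants_descent hcard hs hF
      fun σ hσ ρ hρ => hinv ⟨σ, hσ⟩ ⟨ρ, hρ⟩
    refine (hfF ρ ρ.2).symm.trans (Eq.trans ?_ (hfF ρ' ρ'.2))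
    exact congrArg (fun x => evalChar x ⟨f, hf⟩) h)
  exact ⟨σ, charVar_ext fun b => hσ _ ⟨b, b.2, rfl⟩⟩

theorem exists_isIsomorphism_hom0 (hcard : (Nat.card H : K) ≠ 0)
    (hs : Subgroup.closure (Set.range s) = ⊤) :
    ∃ φ : MulAction.orbitRel.Quotient (hom' H s A) (hom0 s A) →
        hom0 s (quotientGroupRegular A H),
      (∀ ρ, φ (Quotient.mk _ ρ) = ⟨project H ρ, project_mem_hom0 hcard hs ρ.2⟩) ∧
      IsIsomorphism (orbitRegular (hom' H s A) (hom0Regular s A))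
        (hom0Regular s (quotientGroupRegular A H)) φ := by
  refine exists_isIsomorphism_orbitRegular (fun ρ ρ' => ⟨fun h => ?_, ?_⟩) ?_ fun f => ⟨?_, ?_⟩
  · obtain ⟨σ, hσ⟩ := exists_smul_eq_of_project_eq (congrArg Subtype.val h)
    exact ⟨⟨σ, mem_hom'_of_smul_mem ρ.2 (hσ.symm ▸ ρ'.2)⟩, Subtype.ext hσ⟩
  · rintro ⟨σ, rfl⟩
    exact Subtype.ext (project_smul (σ : Γ →* H) (ρ : Γ →* G)).symm
  · rintro ⟨z, hz⟩
    have hz' := hz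
    rw [← project_image_hom0 A hcard hs] at hz'
    obtain ⟨ρ, hρ, rfl⟩ := hz'
    exact ⟨⟨ρ, hρ⟩, rfl⟩
  · rintro ⟨F, hF, rfl⟩
    exact ⟨_, project_mem_homRegular hF, rfl⟩
  · rintro ⟨F, hF, hFf⟩
    have hFf' (ρ : hom0 s A) : F ρ = f ⟨project H ρ, project_mem_hom0 hcard hs ρ.2⟩ :=
      congrFun hFf ρ
    obtain ⟨f', hf', h, -⟩ := exists_homRegular_descent hcard hs hF fun σ hσ ρ hρ => by
      refine (hFf' ((⟨σ, hσ⟩ : hom' H s A) • (⟨ρ, hρ⟩ : hom0 s A))).trans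
        (Eq.trans ?_ (hFf' ⟨ρ, hρ⟩).symm)
      exact congrArg f (Subtype.ext (project_smul σ ρ))
    refine ⟨f', hf', ?_⟩
    ext ⟨z, hz⟩
    have hz' := hz
    rw [← project_image_hom0 A hcard hs] at hz'
    obtain ⟨ρ, hρ, rfl⟩ := hz'
    exact (h ρ hρ).trans (hFf' ⟨ρ, hρ⟩)

theorem exists_isIsomorphism_char0 (hcard : (Nat.card H : K) ≠ 0)
    (hs : Subgroup.closure (Set.range s) = ⊤) :
    ∃ ψ : MulAction.orbitRel.Quotient (hom' H s A) (char0 s A) →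
        char0 s (quotientGroupRegular A H),
      (∀ x, ψ (Quotient.mk _ x) = ⟨charProject s A H x, charProject_mem_char0 hcard hs x.2⟩) ∧
      IsIsomorphism (orbitRegular (hom' H s A) (char0Regular s A))
        (char0Regular s (quotientGroupRegular A H)) ψ := by
  refine exists_isIsomorphism_orbitRegular (fun x y => ⟨fun h => ?_, ?_⟩) ?_ fun f => ⟨?_, ?_⟩
  · obtain ⟨_, ρ, hρ, rfl⟩ := x
    obtain ⟨_, ρ', hρ', rfl⟩ := y
    obtain ⟨σ, hσ⟩ := exists_smul_toChar_eq (ρ := ⟨ρ, hρ⟩) (ρ' := ⟨ρ', hρ'⟩) hcard hs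
      (congrArg Subtype.val h)
    exact ⟨σ, Subtype.ext hσ⟩
  · rintro ⟨σ, rfl⟩
    exact Subtype.ext (charProject_smul (σ : Γ →* H) (x : CharVar s A)).symm
  · rintro ⟨_, z, hz, rfl⟩
    rw [← project_image_hom0 A hcard hs] at hz
    obtain ⟨ρ, hρ, rfl⟩ := hz
    exact ⟨⟨_, ρ, hρ, rfl⟩, rfl⟩
  · rintro hf
    obtain ⟨F, hF, h⟩ := mem_char0Regular_iff.1 hf
    exact mem_char0Regular_iff.2 ⟨_, (invariantsProject s A H ⟨F, hF⟩).2,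
      fun ρ => h ⟨project H ρ, project_mem_hom0 hcard hs ρ.2⟩⟩
  · intro hf
    obtain ⟨F, hF, h⟩ := mem_char0Regular_iff.1 hf
    obtain ⟨f', hf', hF'⟩ := exists_invariants_descent hcard hs hF fun σ hσ ρ hρ => by
      refine (h ((⟨σ, hσ⟩ : hom' H s A) • (⟨ρ, hρ⟩ : hom0 s A))).symm.trans
        (Eq.trans ?_ (h ⟨ρ, hρ⟩))
      exact congrArg f (Subtype.ext (charProject_smul σ (toChar s A ρ)))
    refine mem_char0Regular_iff.2 ⟨f', hf', ?_⟩
    rintro ⟨z, hz⟩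
    have hz' := hz
    rw [← project_image_hom0 A hcard hs] at hz'
    obtain ⟨ρ, hρ, rfl⟩ := hz'
    exact (h ⟨ρ, hρ⟩).trans (hF' ρ hρ).symm

end CharVar

/-! ### Free groups: the whole character variety. -/

section Free

variable {K : Type*} [Field K] {G : Type*} [Group G] {N : ℕ}
  {A : Subalgebra K (G → K)} {H : Subgroup G} [IsCentralSubgroup H]

theorem closure_range_freeGroup_of :
    Subgroup.closure (Set.range (FreeGroup.of : Fin N → FreeGroup (Fin N))) = ⊤ :=
  FreeGroup.closure_range_of _

theorem project_surjective_of_free :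
    Function.Surjective (project H : (FreeGroup (Fin N) →* G) → _) := by
  intro z
  choose x hx using fun i => QuotientGroup.mk_surjective (z (FreeGroup.of i))
  refine ⟨FreeGroup.lift x, ?_⟩
  ext i
  simp [project, hx]

theorem tupleToHom_surjective : Function.Surjective (tupleToHom N H) := by
  intro σ
  refine ⟨fun i => σ (FreeGroup.of i), ?_⟩
  ext i
  simp [tupleToHom]

theorem invariantsProject_injective_of_free :
    Function.Injective (invariantsProject (FreeGroup.of : Fin N → _) A H) := by
  intro f f' h
  refine Subtype.ext (funext fun z => ?_)
  obtain ⟨ρ, rfl⟩ := project_surjective_of_free (H := H) z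
  exact congrFun (congrArg Subtype.val h) ρ

variable [IsAffineAlgebraicGroup A] [Finite H]

/-- Every representation into $G/H$ lifts, so `b` descends as a function; it is regular by
averaging, as every tuple is now a representation. -/
theorem exists_invariantsProject_eq_of_free (hcard : (Nat.card H : K) ≠ 0)
    (b : invariants (FreeGroup.of : Fin N → _) A)
    (hb : ∀ (σ : FreeGroup (Fin N) →* H) ρ,
      (b : (FreeGroup (Fin N) →* G) → K) (σ • ρ) = (b : (FreeGroup (Fin N) →* G) → K) ρ) :
    ∃ c, invariantsProject FreeGroup.of A H c = b := by
  let c (z : FreeGroup (Fin N) →* G ⧸ H) : K :=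
    (b : (FreeGroup (Fin N) →* G) → K) (Function.surjInv project_surjective_of_free z)
  have hc (ρ : FreeGroup (Fin N) →* G) :
      c (project H ρ) = (b : (FreeGroup (Fin N) →* G) → K) ρ := by
    obtain ⟨σ, hσ⟩ := exists_smul_eq_of_project_eq
      (Function.surjInv_eq (project_surjective_of_free (H := H)) (project H ρ))
    exact (hb σ _).symm.trans (congrArg b.1 hσ)
  refine ⟨⟨c, (mem_homRegular_quotientGroupRegular_iff hcard closure_range_freeGroup_of).2 ?_,
    fun g z => ?_⟩, Subtype.ext (funext hc)⟩
  · have hb' := b.2.1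
    rw [homRegular_eq_map (H := H)] at hb'
    obtain ⟨F, hF, hFb⟩ := hb'
    have hFc : F = fun x => c (toQuotientHom FreeGroup.of H x) := by
      ext x
      have hx : tupleOfHom FreeGroup.of H (FreeGroup.lift (x : Fin N → G)) = x :=
        Subtype.ext (funext fun i => FreeGroup.lift_apply_of)
      rw [← hx, toQuotientHom_tupleOfHom closure_range_freeGroup_of, hc, ← hFb]
      rfl
    exact hFc ▸ hF
  · obtain ⟨g, rfl⟩ := QuotientGroup.mk_surjective g
    obtain ⟨ρ, rfl⟩ := project_surjective_of_free z
    rw [← project_conj, hc, hc, b.2.2]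

variable [IsAlgClosed K]

/-- A point of the categorical quotient is an algebra homomorphism, and need not be given as the
class of a representation. It is therefore lifted along the integral extension of invariant
algebras. -/
theorem charProject_surjective_of_free (hcard : (Nat.card H : K) ≠ 0) :
    Function.Surjective (charProject (FreeGroup.of : Fin N → _) A H) := by
  intro z
  have := finite_monoidHom (G := H) (closure_range_freeGroup_of (N := N))
  let _ := invariantsAction (FreeGroup.of : Fin N → _) A H
  obtain ⟨χ, hχ⟩ := exists_algHom_comp_eq_of_invariants (M := FreeGroup (Fin N) →* H)
    (invariantsProject FreeGroup.of A H) invariantsProject_injective_of_free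
    (fun σ c => Subtype.ext (funext fun ρ => congrArg c.1 (project_smul σ ρ)))
    (fun b hb => exists_invariantsProject_eq_of_free hcard b fun σ ρ =>
      congrFun (congrArg Subtype.val (hb σ)) ρ) (evalChar z)
  exact ⟨χ, charVar_ext hχ⟩

theorem exists_isIsomorphism_charVar_of_free (hcard : (Nat.card H : K) ≠ 0) :
    ∃ ψ : MulAction.orbitRel.Quotient (Fin N → H) (CharVar (FreeGroup.of : Fin N → _) A) →
        CharVar (FreeGroup.of : Fin N → _) (quotientGroupRegular A H),
      (∀ x, ψ (Quotient.mk _ x) = charProject FreeGroup.of A H x) ∧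
      IsIsomorphism (orbitRegular (Fin N → H) (charRegular (FreeGroup.of : Fin N → _) A))
        (charRegular (FreeGroup.of : Fin N → _) (quotientGroupRegular A H)) ψ := by
  have hsmul (h : Fin N → H) (x : CharVar (FreeGroup.of : Fin N → _) A) :
      h • x = tupleToHom N H h • x := rfl
  have hdesc (b : invariants (FreeGroup.of : Fin N → _) A)
      (hb : ∀ (h : Fin N → H) x, evalChar (h • x) b = evalChar x b) :
      ∃ c, invariantsProject FreeGroup.of A H c = b := by
    refine exists_invariantsProject_eq_of_free hcard b fun σ ρ => ?_
    obtain ⟨h, rfl⟩ := tupleToHom_surjective σ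
    exact hb h (toChar FreeGroup.of A ρ)
  refine exists_isIsomorphism_orbitRegular (fun x y => ⟨fun hxy => ?_, ?_⟩)
    (charProject_surjective_of_free hcard) fun f => ⟨fun hf => ?_, fun hf => ?_⟩
  · have hM (h : Fin N → H) : ∀ f ∈ charRegular (FreeGroup.of : Fin N → _) A,
        (fun x => f (h • x)) ∈ charRegular (FreeGroup.of : Fin N → _) A := by
      intro f hf
      obtain ⟨b, hb⟩ := mem_charRegular_iff.1 hf
      exact mem_charRegular_iff.2
        ⟨invariantsSMul FreeGroup.of A (tupleToHom N H h) b, fun x => hb (h • x)⟩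
    -- An $H^N$-invariant function on $X_G$ is pulled back from $X_{G/H}$, so it takes equal values
    -- at two points with the same image.
    obtain ⟨h, hh⟩ := exists_smul_of_invariants_eq hM (x := x) (y := y) fun g hg hinv => by
      obtain ⟨b, hb⟩ := mem_charRegular_iff.1 hg
      obtain ⟨c, rfl⟩ := hdesc b fun h x => by rw [← hb, ← hb, hinv]
      rw [hb, hb]
      exact congrArg (fun z => evalChar z c) hxy
    exact ⟨h, charVar_ext fun b => hh _ (mem_charRegular_iff.2 ⟨b, fun _ => rfl⟩)⟩
  · rintro ⟨h, rfl⟩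
    exact (charProject_smul (tupleToHom N H h) x).symm
  · obtain ⟨c, hc⟩ := mem_charRegular_iff.1 hf
    exact mem_charRegular_iff.2 ⟨invariantsProject FreeGroup.of A H c, fun x => hc _⟩
  · obtain ⟨b, hb⟩ := mem_charRegular_iff.1 hf
    obtain ⟨c, rfl⟩ := hdesc b fun h x => by
      rw [← hb, ← hb, hsmul, charProject_smul]
    refine mem_charRegular_iff.2 ⟨c, fun z => ?_⟩
    obtain ⟨x, rfl⟩ := charProject_surjective_of_free hcard z
    exact hb x

end Free

end CharacterVariety

open CharacterVariety in
theorem proposition2p1 {K : Type*} [Field K] [IsAlgClosed K]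
    {G : Type*} [Group G] (A : Subalgebra K (G → K)) [IsAffineAlgebraicGroup A]
    (hG : IsReductive A)
    (H : Subgroup G) [IsCentralSubgroup H] [Finite H] (hchar : (Nat.card H : K) ≠ 0) :
    -- every finitely generated group `Γ`, with any finite list `s` of generators
    (∀ {Γ : Type*} [Group Γ] {N : ℕ} (s : Fin N → Γ), Subgroup.closure (Set.range s) = ⊤ →
      ∃ φ : MulAction.orbitRel.Quotient (hom' H s A) (hom0 s A) →
          hom0 s (quotientGroupRegular A H),
        (∀ ρ : hom0 s A, (φ (Quotient.mk _ ρ) : Γ →* G ⧸ H) = project H (ρ : Γ →* G)) ∧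
        IsIsomorphism (orbitRegular (hom' H s A) (hom0Regular s A))
          (hom0Regular s (quotientGroupRegular A H)) φ ∧
        ∃ ψ : MulAction.orbitRel.Quotient (hom' H s A) (char0 s A) →
            char0 s (quotientGroupRegular A H),
          (∀ ρ : hom0 s A, ψ (Quotient.mk _ (toChar0 s A ρ)) =
            toChar0 s (quotientGroupRegular A H) (φ (Quotient.mk _ ρ))) ∧
          IsIsomorphism (orbitRegular (hom' H s A) (char0Regular s A))
            (char0Regular s (quotientGroupRegular A H)) ψ) ∧
    -- free groups
    (∀ N : ℕ,
      ∃ ψ : MulAction.orbitRel.Quotient (Fin N → H)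
            (CharVar (FreeGroup.of : Fin N → FreeGroup (Fin N)) A) →
          CharVar (FreeGroup.of : Fin N → FreeGroup (Fin N)) (quotientGroupRegular A H),
        (∀ ρ : FreeGroup (Fin N) →* G, ψ (Quotient.mk _ (toChar FreeGroup.of A ρ)) =
          toChar FreeGroup.of (quotientGroupRegular A H) (project H ρ)) ∧
        IsIsomorphism
          (orbitRegular (Fin N → H)
            (charRegular (FreeGroup.of : Fin N → FreeGroup (Fin N)) A))
          (charRegular (FreeGroup.of : Fin N → FreeGroup (Fin N)) (quotientGroupRegular A H))
          ψ) := by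
  refine ⟨fun {Γ} _ {N} s hs => ?_, fun N => ?_⟩
  · obtain ⟨φ, hφ, hφ'⟩ := exists_isIsomorphism_hom0 (A := A) (H := H) hchar hs
    obtain ⟨ψ, hψ, hψ'⟩ := exists_isIsomorphism_char0 (A := A) (H := H) hchar hs
    refine ⟨φ, fun ρ => congrArg Subtype.val (hφ ρ), hφ', ψ, fun ρ => ?_, hψ'⟩
    rw [hψ, hφ]
    rfl
  · obtain ⟨ψ, hψ, hψ'⟩ := exists_isIsomorphism_charVar_of_free (N := N) (A := A) (H := H) hchar
    exact ⟨ψ, fun ρ => hψ _, hψ'⟩
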